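/- Let $\mathcal A$ be an abelian length category, that is, an abelian category in which every object has a composition series. Subcategories are full and closed under isomorphisms. Let $\operatorname{tors}\mathcal A$ be the complete lattice, ordered by inclusion, of torsion classes of $\mathcal A$ (subcategories containing $0$ and closed under quotients and extensions); for a collection $\mathcal C$ of objects, let $T(\mathcal C)$ be the smallest torsion class containing $\mathcal C$ and ${}^{\perp}\mathcal C=\{M \mid \operatorname{Hom}(M,X)=0 \text{ for all } X\in\mathcal C\}$. A wide subcategory is a subcategory containing $0$ and closed under extensions, kernels and cokernels. A brick is an object whose endomorphism ring is a division ring, and a semibrick is a set of isomorphism classes of bricks with no non-zero morphisms between distinct members. Let $\operatorname{wide}\mathcal A$ and $\operatorname{sbrick}\mathcal A$ be the sets of wide subcategories and of semibricks. $\operatorname{Filt}\mathcal S$ is the subcategory of objects with a finite filtration whose subquotients lie in $\mathcal S$, and $\operatorname{simp}\mathcal W$ is the set of isomorphism classes of simple objects of the abelian category $\mathcal W$. In a complete lattice $L$, a canonical join representation of $x$ is an antichain $A=\mathrm{CJR}(x)$ with $x=\bigvee A$ such that whenever $x=\bigvee B$, every $a\in A$ satisfies $a\le b$ for some $b\in B$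 (such an $A$ is unique if it exists, and its members are completely join-irreducible); the canonical meet representation $\mathrm{CMR}(x)$ is defined dually. Let $L_0$ and $L^0$ be the sets of elements having a canonical join representation and a canonical meet representation, respectively. For a completely join-irreducible $j$ put $j_*=\bigvee\{x\mid x<j\}$ and $\kappa(j)=\max\{x\mid j\wedge x=j_*\}$, and for $x\in L_0$ put $\bar\kappa(x)=\bigwedge\{\kappa(j)\mid j\in \mathrm{CJR}(x)\}$. For $L=\operatorname{tors}\mathcal A$, let $\overline{\mathrm{CJR}}(\mathcal T)$ be the set of isomorphism classes of bricks $B$ with $T(B)\in\mathrm{CJR}(\mathcal T)$, for $\mathcal T\in L_0$, and let $\overline{\mathrm{CMR}}(\mathcal T)$ be the set of isomorphism classes of bricks $B$ with ${}^{\perp}B\in\mathrm{CMR}(\mathcal T)$, for $\mathcal T\in L^0$. Then for $L=\operatorname{tors}\mathcal A$ the maximum defining $\kappa(j)$ exists for every completely join-irreducible $j$, and: 1. $\bar\kappa$ is a bijection $(\operatorname{tors}\mathcal A)_0\to(\operatorname{tors}\mathcal A)^0$. 2. $T:\operatorname{sbrick}\mathcal A\to(\operatorname{tors}\mathcal A)_0$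 and $\overline{\mathrm{CJR}}$ are mutually inverse bijections; ${}^{\perp}(-):\operatorname{sbrick}\mathcal A\to(\operatorname{tors}\mathcal A)^0$ and $\overline{\mathrm{CMR}}$ are mutually inverse bijections; $\operatorname{Filt}:\operatorname{sbrick}\mathcal A\to\operatorname{wide}\mathcal A$ and $\operatorname{simp}$ are mutually inverse bijections; and $T:\operatorname{wide}\mathcal A\to(\operatorname{tors}\mathcal A)_0$ and ${}^{\perp}(-):\operatorname{wide}\mathcal A\to(\operatorname{tors}\mathcal A)^0$ are bijections. 3. These maps commute: for $\mathcal S\in\operatorname{sbrick}\mathcal A$ and $\mathcal W\in\operatorname{wide}\mathcal A$ we have $T(\operatorname{Filt}\mathcal S)=T(\mathcal S)$, ${}^{\perp}(\operatorname{Filt}\mathcal S)={}^{\perp}\mathcal S$, $T(\operatorname{simp}\mathcal W)=T(\mathcal W)$ and ${}^{\perp}(\operatorname{simp}\mathcal W)={}^{\perp}\mathcal W$; and for $\mathcal T\in(\operatorname{tors}\mathcal A)_0$ we have $\bar\kappa(\mathcal T)={}^{\perp}\bigl(\overline{\mathrm{CJR}}(\mathcal T)\bigr)$ and $\overline{\mathrm{CMR}}(\bar\kappa(\mathcal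 T))=\overline{\mathrm{CJR}}(\mathcal T)$. In particular $\bar\kappa(T(\mathcal S))={}^{\perp}\mathcal S$ for every semibrick $\mathcal S$, and $\bar\kappa(T(\mathcal W))={}^{\perp}\mathcal W$ for every wide subcategory $\mathcal W$. -/

import Mathlib

open CategoryTheory CategoryTheory.Limits ZeroObject

universe v u

namespace TorsKappa

/-! ### Canonical representations and the kappa map in a complete lattice -/

section Lattice

variable {L : Type*} [CompleteLattice L]

/-- `j` is completely join-irreducible: `j = ⋁ X` implies `j ∈ X`. -/
def IsCompletelyJoinIrreducible (j : L) : Prop :=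
  ∀ X : Set L, j = sSup X → j ∈ X

/-- The element `j_* = ⋁ {x | x < j}`. -/
def lowerStar (j : L) : L := sSup {x | x < j}

/-- The kappa map `κ(j) = max {x | j ∧ x = j_*}` (for completely join-irreducible `j`). The maximum,
when it exists, is the supremum. -/
def kappa (j : L) : L := sSup {x | j ⊓ x = lowerStar j}

/-- `x = ⋁ A` is a canonical join representation: `A` is an antichain refining every join
representation of `x`. -/
structure IsCanonicalJoinRep (x : L) (A : Set L) : Prop where
  eq_sSup : x = sSup A
  refines : ∀ B : Set L, x = sSup B → ∀ a ∈ A, ∃ b ∈ B, a ≤ b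
  antichain : ∀ a₁ ∈ A, ∀ a₂ ∈ A, a₁ ≤ a₂ → a₁ = a₂

/-- `x = ⋀ A` is a canonical meet representation. -/
structure IsCanonicalMeetRep (x : L) (A : Set L) : Prop where
  eq_sInf : x = sInf A
  refines : ∀ B : Set L, x = sInf B → ∀ a ∈ A, ∃ b ∈ B, b ≤ a
  antichain : ∀ a₁ ∈ A, ∀ a₂ ∈ A, a₁ ≤ a₂ → a₁ = a₂

theorem IsCanonicalJoinRep.unique {x : L} {A B : Set L} (hA : IsCanonicalJoinRep x A)
    (hB : IsCanonicalJoinRep x B) : A = B := by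
  have key : ∀ {A B : Set L}, IsCanonicalJoinRep x A → IsCanonicalJoinRep x B → A ⊆ B := by
    intro A B hA hB a ha
    obtain ⟨b, hb, hab⟩ := hA.refines B hB.eq_sSup a ha
    obtain ⟨a', ha', hba'⟩ := hB.refines A hA.eq_sSup b hb
    obtain rfl := hA.antichain a ha a' ha' (hab.trans hba')
    rwa [le_antisymm hab hba']
  exact Set.Subset.antisymm (key hA hB) (key hB hA)

theorem IsCanonicalMeetRep.unique {x : L} {A B : Set L} (hA : IsCanonicalMeetRep x A)
    (hB : IsCanonicalMeetRep x B) : A = B := by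
  have key : ∀ {A B : Set L}, IsCanonicalMeetRep x A → IsCanonicalMeetRep x B → A ⊆ B := by
    intro A B hA hB a ha
    obtain ⟨b, hb, hab⟩ := hA.refines B hB.eq_sInf a ha
    obtain ⟨a', ha', hba'⟩ := hB.refines A hA.eq_sInf b hb
    obtain rfl := hA.antichain a' ha' a ha (hba'.trans hab)
    rwa [le_antisymm hba' hab]
  exact Set.Subset.antisymm (key hA hB) (key hB hA)

variable (L) in
/-- `L_0`: the elements having a canonical join representation. -/
def lowerZero : Set L := {x | ∃ A, IsCanonicalJoinRep x A}

variable (L) in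
/-- `L^0`: the elements having a canonical meet representation. -/
def upperZero : Set L := {x | ∃ A, IsCanonicalMeetRep x A}

/-- `CJR(x)`: the members of the canonical join representation of `x` (for `x ∈ L_0`). -/
def CJR (x : L) : Set L := {a | ∃ A, IsCanonicalJoinRep x A ∧ a ∈ A}

/-- `CMR(x)`: the members of the canonical meet representation of `x` (for `x ∈ L^0`). -/
def CMR (x : L) : Set L := {a | ∃ A, IsCanonicalMeetRep x A ∧ a ∈ A}

theorem IsCanonicalJoinRep.cjr_eq {x : L} {A : Set L} (hA : IsCanonicalJoinRep x A) :
    CJR x = A :=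
  Set.ext fun _ => ⟨fun ⟨_, hB, h⟩ => hB.unique hA ▸ h, fun h => ⟨A, hA, h⟩⟩

theorem IsCanonicalMeetRep.cmr_eq {x : L} {A : Set L} (hA : IsCanonicalMeetRep x A) :
    CMR x = A :=
  Set.ext fun _ => ⟨fun ⟨_, hB, h⟩ => hB.unique hA ▸ h, fun h => ⟨A, hA, h⟩⟩

/-- Members of a canonical join representation are completely join-irreducible, so that `kappa`
is applied only to such elements in the extended kappa map. -/
theorem IsCanonicalJoinRep.irreducible {x : L} {A : Set L} (hA : IsCanonicalJoinRep x A) {a : L}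
    (ha : a ∈ A) : IsCompletelyJoinIrreducible a := by
  intro B hB
  have hx : x = sSup (B ∪ (A \ {a})) := by
    rw [sSup_union, ← hB, ← sSup_insert, Set.insert_sdiff_singleton, Set.insert_eq_of_mem ha]
    exact hA.eq_sSup
  obtain ⟨b, hb | hb, hab⟩ := hA.refines _ hx a ha
  · have hba : b ≤ a := hB ▸ le_sSup hb
    rwa [le_antisymm hab hba]
  · exact absurd (hA.antichain a ha b hb.1 hab).symm hb.2

/-- The extended kappa map `x ↦ ⋀ {κ(j) | j ∈ CJR(x)}` (for `x ∈ L_0`). -/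
def extKappa (x : L) : L := sInf (kappa '' CJR x)

end Lattice

/-! ### Subcategories of an abelian category -/

section Category

variable (C : Type u) [Category.{v} C] [Abelian C]

/-- `C` is a length category: every object has a composition series, i.e. a finite chain of
subobjects from `0` to the whole object, each one maximal in the next. -/
def IsLengthCategory : Prop :=
  ∀ X : C, ∃ s : RelSeries {p : Subobject X × Subobject X | p.1 ⋖ p.2},
    s.head = ⊥ ∧ s.last = ⊤

variable {C}

/-- A torsion class: it contains the zero objects and is closed under quotients and extensions
(hence also under isomorphisms). -/
structure IsTorsionClass (P : ObjectProperty C) : Prop where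
  containsZero : P.ContainsZero
  quotients : P.IsClosedUnderQuotients
  extensions : P.IsClosedUnderExtensions

variable (C) in
/-- `tors C`, ordered by inclusion. -/
abbrev Tors : Type u := {P : ObjectProperty C // IsTorsionClass P}

/-- Torsion classes are closed under arbitrary intersections. -/
instance : InfSet (Tors C) where
  sInf X := ⟨fun M => ∀ T ∈ X, T.1 M,
    { containsZero := ⟨0, isZero_zero C, fun T _ => by
        have := T.2.containsZero
        have := T.2.quotients
        exact T.1.prop_zero⟩
      quotients := ⟨fun f _ h T hT => by
        have := T.2.quotients
        exact T.1.prop_of_epi f (h T hT)⟩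
      extensions := ⟨fun hS h₁ h₃ T hT => by
        have := T.2.extensions
        exact T.1.prop_X₂_of_shortExact hS (h₁ T hT) (h₃ T hT)⟩ }⟩

/-- The complete lattice `tors C`, whose meets are intersections. -/
instance : CompleteLattice (Tors C) :=
  completeLatticeOfInf (Tors C) fun _ =>
    ⟨fun T hT _ hM => hM T hT, fun _ hU M hM _ hT => hU hT M hM⟩

/-- The smallest torsion class containing `P`. -/
def torsClosure (P : ObjectProperty C) : Tors C := sInf {T | P ≤ T.1}

/-- The left Hom-orthogonal `⊥P = {M | Hom(M, X) = 0 for all X in P}`, which is a torsion class. -/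
def leftPerp (P : ObjectProperty C) : Tors C :=
  ⟨P.leftOrthogonal,
    { containsZero := inferInstance
      quotients := ⟨fun f _ h Y g hY => by
        rw [← cancel_epi f, comp_zero]
        exact h _ hY⟩
      extensions := ⟨fun {S} hS h₁ h₃ Y g hY => by
        have := hS.epi_g
        have h : S.f ≫ g = 0 := h₁ _ hY
        rw [← hS.exact.g_desc g h, h₃ (hS.exact.desc g h) hY, comp_zero]⟩ }⟩

/-- A brick: an object whose endomorphism ring is a division ring. -/
def IsBrick (B : C) : Prop :=
  Nontrivial (End B) ∧ ∀ f : End B, f ≠ 0 → IsUnit f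

/-- The isomorphism class of an object. -/
def isoClass (B : C) : ObjectProperty C := fun X => Nonempty (X ≅ B)

variable (C) in
/-- `sbrick C`: the semibricks. A set of isomorphism classes of objects is given as an
isomorphism-closed property of objects. -/
def sbrick : Set (ObjectProperty C) :=
  {S | S.IsClosedUnderIsomorphisms ∧ (∀ B, S B → IsBrick B) ∧
    ∀ B₁ B₂, S B₁ → S B₂ → ¬ Nonempty (B₁ ≅ B₂) → ∀ f : B₁ ⟶ B₂, f = 0}

variable (C) in
/-- `wide C`: the wide subcategories, i.e. the (nonempty, full, isomorphism-closed) subcategories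
closed under extensions, kernels and cokernels. -/
def wide : Set (ObjectProperty C) :=
  {W | W.IsClosedUnderIsomorphisms ∧ W.ContainsZero ∧ W.IsClosedUnderExtensions ∧
    W.IsClosedUnderKernels ∧ W.IsClosedUnderCokernels}

/-- `Filt P`: the objects `M` with a finite filtration `0 = M₀ ⊆ M₁ ⊆ ⋯ ⊆ Mₙ = M` whose
subquotients `Mᵢ₊₁ / Mᵢ` belong to `P`. -/
def filt (P : ObjectProperty C) : ObjectProperty C := fun M =>
  ∃ (n : ℕ) (F : ℕ → Subobject M) (hF : Monotone F), F 0 = ⊥ ∧ F n = ⊤ ∧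
    ∀ i < n, P (cokernel ((F i).ofLE (F (i + 1)) (hF i.le_succ)))

/-- `simp W`: the objects of `W` that are simple objects of the category `W`. -/
def simpleObjects (W : ObjectProperty C) : ObjectProperty C := fun X =>
  ∃ h : W X, Simple (⟨X, h⟩ : W.FullSubcategory)

/-- The set of (isomorphism classes of) bricks corresponding to `CJR(T)` under the correspondence
`B ↔ T(B)` between bricks and completely join-irreducible torsion classes. -/
def cjrBricks (T : Tors C) : ObjectProperty C := fun B =>
  IsBrick B ∧ torsClosure (isoClass B) ∈ CJR T

/-- The set of (isomorphism classes of) bricks corresponding to `CMR(T)` under the correspondence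
`B ↔ ⊥B` between bricks and completely meet-irreducible torsion classes. -/
def cmrBricks (T : Tors C) : ObjectProperty C := fun B =>
  IsBrick B ∧ leftPerp (isoClass B) ∈ CMR T

end Category

end TorsKappa

open TorsKappa

/-! Every bijection is read off from semibricks. For a brick $B$, a non-zero map from $T(B)$ to $B$
is epi, so the largest torsion class strictly below $T(B)$ is $T(B)\cap{}^\perp B$, and ${}^\perp B$
turns out to be the largest class meeting $T(B)$ in it: $\kappa(T(B))={}^\perp B$
(`kappa_torsClosure`).

For a semibrick $S$ and $B\in S$, non-zero maps from $T(S)$ to $B$ are epi, and non-zero maps from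
$B$ to the torsion-free class of ${}^\perp S$ are mono. Hence a torsion class below $T(S)$, or above
${}^\perp S$, either contains $B$ or lies in ${}^\perp B$. This dichotomy makes $\bigvee T(B)$ and
$\bigwedge{}^\perp B$ canonical (`isCanonicalJoinRep_torsClosure`, `isCanonicalMeetRep_leftPerp`).

Conversely, finite length yields a brick separating any $T\not\le U$ (`exists_brick_of_not_le`), so
the members of a canonical representation come from bricks. A non-zero map between two distinct ones
would allow one member to be replaced in the representation, contradicting canonicity
(`cjrBricks_mem_sbrick`, `cmrBricks_mem_sbrick`).

For wide subcategories, kernels and cokernels of filtered objects are controlled by induction on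
filtrations (`FiltBy.kernel_and_cokernel`), and finite length gives filtrations by simples
(`filtBy_simpleObjects`). Since $T$ and ${}^\perp$ do not see the difference between $S$ and
$\operatorname{Filt} S$, everything commutes. -/

namespace TorsKappa

/-! ### Modularity of subobject lattices. -/

section Subobjects

variable {C : Type u} [Category.{v} C] [Abelian C]

/-- Epimorphisms are strong, so the square against the monomorphism `Q.arrow` has a diagonal filler.
-/
theorem le_of_epi_refinement {X A : C} {P Q : Subobject X} (π : A ⟶ (P : C)) [Epi π]
    (h : Q.Factors (π ≫ P.arrow)) : P ≤ Q := by
  have := strongEpi_of_epi π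
  have sq : CommSq (Q.factorThru _ h) π Q.arrow P.arrow := ⟨by simp⟩
  exact Subobject.le_of_comm sq.lift sq.fac_right

theorem exists_refinement_of_factors_sup {X A : C} {P Q : Subobject X} {f : A ⟶ X}
    (h : (P ⊔ Q).Factors f) : ∃ (A' : C) (π : A' ⟶ A) (_ : Epi π) (p : A' ⟶ (P : C))
      (q : A' ⟶ (Q : C)), π ≫ f = p ≫ P.arrow + q ≫ Q.arrow := by
  let φ := biprod.desc P.arrow Q.arrow
  have hle : P ⊔ Q ≤ Subobject.mk (image.ι φ) :=
    sup_le (Subobject.le_mk_of_comm (biprod.inl ≫ factorThruImage φ) (by simp [φ]))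
      (Subobject.le_mk_of_comm (biprod.inr ≫ factorThruImage φ) (by simp [φ]))
  obtain ⟨g, hg⟩ : ∃ g : A ⟶ image φ, g ≫ image.ι φ = f :=
    (Subobject.mk_factors_iff _ _).1 (Subobject.factors_of_le f hle h)
  obtain ⟨A', π, hπ, x, hx⟩ := surjective_up_to_refinements_of_epi (factorThruImage φ) g
  refine ⟨A', π, hπ, x ≫ biprod.fst, x ≫ biprod.snd, ?_⟩
  have h2 : x ≫ φ = π ≫ f := by
    rw [← image.fac φ, ← reassoc_of% hx, hg]
  rw [← h2]
  simp only [φ, biprod.desc_eq, Preadditive.comp_add, Category.assoc]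

/-- The usual element argument, with epi refinements as elements: if $p+q\in R$ and $p\in P\le R$,
then $q\in R$. -/
instance (X : C) : IsModularLattice (Subobject X) where
  sup_inf_le_assoc_of_le {P} Q R hPR := by
    obtain ⟨A, π, hπ, p, q, h⟩ := exists_refinement_of_factors_sup
      (Subobject.factors_of_le (((P ⊔ Q) ⊓ R).arrow) (inf_le_left (b := R))
        (Subobject.factors_self _))
    refine le_of_epi_refinement π ?_
    have hq : R.Factors (q ≫ Q.arrow) := by
      have h1 : q ≫ Q.arrow = π ≫ ((P ⊔ Q) ⊓ R).arrow + (-p) ≫ P.arrow := by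
        rw [h, Preadditive.neg_comp]; abel
      rw [h1]
      exact Subobject.factors_add _ _ (Subobject.factors_of_factors_right _
          (Subobject.factors_of_le _ (inf_le_right (a := P ⊔ Q)) (Subobject.factors_self _)))
        (Subobject.factors_of_le _ hPR (Subobject.factors_comp_arrow _))
    rw [h]
    exact Subobject.factors_add _ _ (Subobject.factors_of_le _ le_sup_left (Subobject.factors_comp_arrow _))
      (Subobject.factors_of_le _ le_sup_right
        ((Subobject.inf_factors _).2 ⟨Subobject.factors_comp_arrow _, hq⟩))

end Subobjects

/-! ### Chain conditions from a composition series. -/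

section ModularLattice

variable {L : Type*} [Lattice L] [IsModularLattice L]

/-- Transfers both chain conditions from $[\bot,a]$ and $[a,b]$ to $[\bot,b]$, which lets them climb
a composition series. -/
theorem strictMono_Iic_prod {a b : L} (h : a ≤ b) : StrictMono
    (fun y : Set.Iic b => ((⟨y.1 ⊓ a, inf_le_right⟩, ⟨y.1 ⊔ a, le_sup_right, sup_le y.2 h⟩) :
      Set.Iic a × Set.Icc a b)) :=
  fun _ _ hxy => strictMono_inf_prod_sup (z := a) (Subtype.coe_lt_coe.2 hxy)

omit [IsModularLattice L] in
theorem finite_Icc_of_covBy {a b : L} (h : a ⋖ b) : Finite (Set.Icc a b) := by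
  rw [h.Icc_eq]
  exact Set.toFinite _

theorem wellFoundedLT_Iic_of_covBy {a b : L} (h : a ⋖ b) [WellFoundedLT (Set.Iic a)] :
    WellFoundedLT (Set.Iic b) :=
  have := finite_Icc_of_covBy h
  (strictMono_Iic_prod h.le).wellFoundedLT

theorem wellFoundedGT_Iic_of_covBy {a b : L} (h : a ⋖ b) [WellFoundedGT (Set.Iic a)] :
    WellFoundedGT (Set.Iic b) :=
  have := finite_Icc_of_covBy h
  (strictMono_Iic_prod h.le).wellFoundedGT

variable [BoundedOrder L]

theorem wellFounded_of_covBy_series (s : RelSeries {p : L × L | p.1 ⋖ p.2}) (h₀ : s.head = ⊥)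
    (h₁ : s.last = ⊤) : WellFoundedLT L ∧ WellFoundedGT L := by
  have key : ∀ i, WellFoundedLT (Set.Iic (s i)) ∧ WellFoundedGT (Set.Iic (s i)) := by
    intro i
    induction i using Fin.induction with
    | zero =>
      have : s 0 = ⊥ := h₀
      rw [this, Set.Iic_bot]
      exact ⟨inferInstance, inferInstance⟩
    | succ i ih =>
      have := ih.1
      have := ih.2
      exact ⟨wellFoundedLT_Iic_of_covBy (s.step i), wellFoundedGT_Iic_of_covBy (s.step i)⟩
  have hl : s (Fin.last _) = ⊤ := h₁
  have := key (Fin.last _)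
  rw [hl, Set.Iic_top] at this
  obtain ⟨_, _⟩ := this
  have hm : StrictMono (fun x : L => (⟨x, trivial⟩ : (Set.univ : Set L))) := fun _ _ h => h
  exact ⟨hm.wellFoundedLT, hm.wellFoundedGT⟩

end ModularLattice

/-! ### Objects of finite length. -/

section Length

variable {C : Type u} [Category.{v} C] [Abelian C]

theorem IsLengthCategory.wellFoundedLT (hC : IsLengthCategory C) (X : C) :
    WellFoundedLT (Subobject X) :=
  let ⟨s, h₀, h₁⟩ := hC X
  (wellFounded_of_covBy_series s h₀ h₁).1

theorem IsLengthCategory.wellFoundedGT (hC : IsLengthCategory C) (X : C) :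
    WellFoundedGT (Subobject X) :=
  let ⟨s, h₀, h₁⟩ := hC X
  (wellFounded_of_covBy_series s h₀ h₁).2

theorem pullback_obj_injective_of_epi {X Y : C} (f : X ⟶ Y) [Epi f] :
    Function.Injective (Subobject.pullback f).obj := by
  have key : ∀ P Q : Subobject Y, (Subobject.pullback f).obj P = (Subobject.pullback f).obj Q →
      P ≤ Q := by
    intro P Q h
    obtain ⟨A, π, hπ, x, hx⟩ := surjective_up_to_refinements_of_epi f P.arrow
    refine le_of_epi_refinement π ?_
    have h1 : ((Subobject.pullback f).obj Q).Factors x := by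
      rw [← h]
      refine (Subobject.factors_iff _ _).2 ⟨(Subobject.isPullback f P).lift π x hx, ?_⟩
      exact (Subobject.isPullback f P).lift_snd π x hx
    rw [hx, ← Subobject.factorThru_arrow _ _ h1, Category.assoc,
      ← (Subobject.isPullback f Q).w, ← Category.assoc]
    exact Subobject.factors_comp_arrow _
  exact fun P Q h => le_antisymm (key P Q h) (key Q P h.symm)

/-- The ascending chain of the kernels of the powers of `f` stabilises; pullback along an
epimorphism is injective on subobjects, so already $\bot=\ker f$. -/
theorem isIso_of_epi_endo {X : C} [WellFoundedGT (Subobject X)] (f : X ⟶ X) [Epi f] :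
    IsIso f := by
  let F : Subobject X → Subobject X := (Subobject.pullback f).obj
  have hF : Monotone F := (Subobject.pullback f).monotone
  have hm : Monotone (fun n => F^[n] ⊥) := Monotone.monotone_iterate_of_le_map hF bot_le
  obtain ⟨n, hn⟩ := WellFoundedGT.monotone_chain_condition (⟨_, hm⟩ : ℕ →o Subobject X)
  have h1 : F^[n] ⊥ = F^[n] (F ⊥) := hn (n + 1) n.le_succ
  have h2 : ⊥ = F ⊥ := (pullback_obj_injective_of_epi f).iterate n h1
  have : Mono f := Preadditive.mono_of_cancel_zero _ fun {A} g hg => by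
    have h3 : (F ⊥).Factors g := by
      refine (Subobject.factors_iff _ _).2 ⟨(Subobject.isPullback f ⊥).lift 0 g (by simp [hg]), ?_⟩
      exact (Subobject.isPullback f ⊥).lift_snd _ _ _
    rwa [← h2, Subobject.bot_factors_iff_zero] at h3
  exact isIso_of_mono_of_epi f

end Length

/-! ### Consequences of the six-term kernel–cokernel sequence of a composite. -/

section KernelCokernel

variable {C : Type u} [Category.{v} C] [Abelian C] {X Y Z : C} (f : X ⟶ Y) (g : Y ⟶ Z)

open kernelCokernelCompSequence

theorem shortExact_kernel_comp_of_mono [Mono f] [Epi (f ≫ g)] : ∃ (i : kernel (f ≫ g) ⟶ kernel g)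
    (p : kernel g ⟶ cokernel f) (w : i ≫ p = 0), (ShortComplex.mk i p w).ShortExact := by
  have h := kernelCokernelCompSequence_exact f g
  have h1 := h.exact 1
  have h2 := h.exact 2
  refine ⟨_, _, _, .mk' h1 ?_ ?_⟩
  · have h3 : kernel.map (f ≫ g) g f (𝟙 Z) (by simp) ≫ kernel.ι g = kernel.ι (f ≫ g) ≫ f := by
      simp
    exact mono_of_mono_fac h3
  · exact h2.epi_f ((isZero_cokernel_of_epi (f ≫ g)).eq_zero_of_tgt _)

theorem shortExact_kernel_comp_of_epi [Epi f] : ∃ (i : kernel f ⟶ kernel (f ≫ g))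
    (p : kernel (f ≫ g) ⟶ kernel g) (w : i ≫ p = 0), (ShortComplex.mk i p w).ShortExact := by
  have h := kernelCokernelCompSequence_exact f g
  have h0 := h.exact 0
  have h1 := h.exact 1
  refine ⟨_, _, _, .mk' h0 ?_ ?_⟩
  · exact inferInstanceAs (Mono ((kernelCokernelCompSequence f g).map' 0 1))
  · exact h1.epi_f ((isZero_cokernel_of_epi f).eq_zero_of_tgt _)

theorem shortExact_cokernel_comp_of_mono [Mono g] : ∃ (i : cokernel f ⟶ cokernel (f ≫ g))
    (p : cokernel (f ≫ g) ⟶ cokernel g) (w : i ≫ p = 0), (ShortComplex.mk i p w).ShortExact := by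
  have h := kernelCokernelCompSequence_exact f g
  have h2 := h.exact 2
  have h3 := h.exact 3
  refine ⟨_, _, _, .mk' h3 ?_ ?_⟩
  · exact h2.mono_g ((isZero_kernel_of_mono g).eq_zero_of_src _)
  · exact inferInstanceAs (Epi ((kernelCokernelCompSequence f g).map' 4 5))

/-- If `f ≫ g` is an epimorphism, the induced map `ker (f ≫ g) ⟶ ker g` has the same kernel and
cokernel as `f`. -/
theorem exists_kernel_map_of_epi_comp [Epi (f ≫ g)] : ∃ t : kernel (f ≫ g) ⟶ kernel g,
    Nonempty (kernel f ≅ kernel t) ∧ Nonempty (cokernel f ≅ cokernel t) := by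
  have h := kernelCokernelCompSequence_exact f g
  have h0 := h.exact 0
  have h1 := h.exact 1
  have h2 := h.exact 2
  have : Mono ((kernelCokernelCompSequence f g).map' 0 1) := inferInstance
  have : Epi ((kernelCokernelCompSequence f g).map' 2 3) :=
    h2.epi_f ((isZero_cokernel_of_epi (f ≫ g)).eq_zero_of_tgt _)
  exact ⟨(kernelCokernelCompSequence f g).map' 1 2,
    ⟨IsLimit.conePointUniqueUpToIso (h0.fIsKernel) (limit.isLimit _)⟩,
    ⟨IsColimit.coconePointUniqueUpToIso (h1.gIsCokernel) (colimit.isColimit _)⟩⟩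

end KernelCokernel

/-! ### Filtrations as iterated extensions. -/

section Filtrations

variable {C : Type u} [Category.{v} C] [Abelian C] {P : ObjectProperty C}

/-- The objects obtained from zero objects by finitely many extensions by objects of `P`. -/
inductive FiltBy (P : ObjectProperty C) : C → Prop
  | zero {M : C} (h : IsZero M) : FiltBy P M
  | step {X Y Z : C} (f : X ⟶ Y) (g : Y ⟶ Z) (w : f ≫ g = 0)
      (h : (ShortComplex.mk f g w).ShortExact) (hX : FiltBy P X) (hZ : P Z) : FiltBy P Y

theorem shortExact_of_iso_X₂ {X Y Y' Z : C} {f : X ⟶ Y} {g : Y ⟶ Z} {w : f ≫ g = 0}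
    (h : (ShortComplex.mk f g w).ShortExact) (e : Y ≅ Y') :
    (ShortComplex.mk (f ≫ e.hom) (e.inv ≫ g) (by simp [w])).ShortExact :=
  ShortComplex.shortExact_of_iso (S₁ := .mk f g w)
    (ShortComplex.isoMk (Iso.refl _) e (Iso.refl _) (by simp) (by simp)) h

theorem shortExact_of_iso_X₁ {X X' Y Z : C} {f : X ⟶ Y} {g : Y ⟶ Z} {w : f ≫ g = 0}
    (h : (ShortComplex.mk f g w).ShortExact) (e : X ≅ X') :
    (ShortComplex.mk (e.inv ≫ f) g (by simp [w])).ShortExact :=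
  ShortComplex.shortExact_of_iso (S₁ := .mk f g w)
    (ShortComplex.isoMk e (Iso.refl _) (Iso.refl _) (by simp) (by simp)) h

theorem shortExact_of_iso_X₃ {X Y Z Z' : C} {f : X ⟶ Y} {g : Y ⟶ Z} {w : f ≫ g = 0}
    (h : (ShortComplex.mk f g w).ShortExact) (e : Z ≅ Z') :
    (ShortComplex.mk f (g ≫ e.hom) (by simp [reassoc_of% w])).ShortExact :=
  ShortComplex.shortExact_of_iso (S₁ := .mk f g w)
    (ShortComplex.isoMk (Iso.refl _) (Iso.refl _) e (by simp) (by simp)) h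

theorem shortExact_cokernel {X Y : C} (f : X ⟶ Y) [Mono f] :
    (ShortComplex.mk f (cokernel.π f) (cokernel.condition f)).ShortExact :=
  .mk' (ShortComplex.exact_cokernel f) ‹_› (inferInstanceAs (Epi (cokernel.π f)))

theorem shortExact_kernel {X Y : C} (f : X ⟶ Y) [Epi f] :
    (ShortComplex.mk (kernel.ι f) f (kernel.condition f)).ShortExact :=
  .mk' (ShortComplex.exact_kernel f) (inferInstanceAs (Mono (kernel.ι f))) ‹_›

/-- In a short exact sequence the last term is the cokernel of the first map. -/
noncomputable def cokernelIsoOfShortExact {X Y Z : C} {f : X ⟶ Y} {g : Y ⟶ Z} {w : f ≫ g = 0}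
    (h : (ShortComplex.mk f g w).ShortExact) : cokernel f ≅ Z :=
  IsColimit.coconePointUniqueUpToIso (cokernelIsCokernel _) h.gIsCokernel

/-- In a short exact sequence the first term is the kernel of the last map. -/
noncomputable def kernelIsoOfShortExact {X Y Z : C} {f : X ⟶ Y} {g : Y ⟶ Z} {w : f ≫ g = 0}
    (h : (ShortComplex.mk f g w).ShortExact) : kernel g ≅ X :=
  IsLimit.conePointUniqueUpToIso (kernelIsKernel _) h.fIsKernel

namespace FiltBy

theorem of_iso {M N : C} (h : FiltBy P M) (e : M ≅ N) : FiltBy P N := by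
  cases h with
  | zero h => exact zero (h.of_iso e.symm)
  | step f g w h hX hZ => exact step _ _ _ (shortExact_of_iso_X₂ h e) hX hZ

instance : ObjectProperty.IsClosedUnderIsomorphisms (FiltBy P) where
  of_iso e h := h.of_iso e

theorem of_prop {M : C} (h : P M) : FiltBy P M :=
  step (0 : 0 ⟶ M) (𝟙 M) (by simp)
    (.mk' ((ShortComplex.exact_iff_mono (.mk (0 : 0 ⟶ M) (𝟙 M) (by simp)) rfl).2
      (inferInstance : Mono (𝟙 M))) ((isZero_zero C).mono _) (inferInstance : Epi (𝟙 M)))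
    (zero (isZero_zero C)) h

/-- Induction on the filtration of the quotient: its top factor $Z$ is also a quotient of $E$, and
the kernel of $E\to Z$ is an extension of a shorter filtered object by $A$. -/
theorem ext {A E M : C} {i : A ⟶ E} {p : E ⟶ M} {w : i ≫ p = 0}
    (h : (ShortComplex.mk i p w).ShortExact) (hA : FiltBy P A) (hM : FiltBy P M) :
    FiltBy P E := by
  induction hM generalizing E A with
  | zero hM =>
    have := h.mono_f
    have : Epi i := h.exact.epi_f (hM.eq_zero_of_tgt _)
    have : IsIso i := isIso_of_mono_of_epi i
    exact hA.of_iso (asIso i)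
  | step f g w' h' _ hZ ih =>
    have : Epi p := h.epi_g
    have : Epi g := h'.epi_g
    obtain ⟨a, b, w₁, h₁⟩ := shortExact_kernel_comp_of_epi p g
    have h₂ := shortExact_of_iso_X₁ h₁ (kernelIsoOfShortExact h)
    have h₃ := shortExact_of_iso_X₃ h₂ (kernelIsoOfShortExact h')
    exact step _ _ _ (shortExact_kernel (p ≫ g)) (ih h₃ hA) hZ

theorem le_of_extensions {Q : ObjectProperty C} [Q.IsClosedUnderIsomorphisms] [Q.ContainsZero]
    [Q.IsClosedUnderExtensions] (h : P ≤ Q) : FiltBy P ≤ Q := by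
  intro M hM
  induction hM with
  | zero h => exact Q.prop_of_isZero h
  | step f g w h' _ hZ ih => exact Q.prop_X₂_of_shortExact h' ih (h _ hZ)

end FiltBy

theorem prop_cokernel_ofLE [P.IsClosedUnderIsomorphisms] {X Y M : C} {α : X ⟶ M} {β : Y ⟶ M}
    [Mono α] [Mono β] {A B : Subobject M} (hA : A = Subobject.mk α) (hB : B = Subobject.mk β)
    {u : X ⟶ Y} (hu : u ≫ β = α) (hAB : A ≤ B) (h : P (cokernel u)) :
    P (cokernel (A.ofLE B hAB)) := by
  subst hA hB
  refine P.prop_of_iso (cokernel.mapIso _ _ (Subobject.underlyingIso α).symm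
    (Subobject.underlyingIso β).symm ?_) h
  rw [← cancel_mono (Subobject.mk β).arrow]
  simp [hu]

theorem filt_eq_filtBy [P.IsClosedUnderIsomorphisms] : filt P = FiltBy P := by
  ext M
  constructor
  · rintro ⟨n, F, hF, h₀, hn, h⟩
    have key : ∀ i ≤ n, FiltBy P (F i : C) := by
      intro i hi
      induction i with
      | zero =>
        rw [h₀]
        exact .zero ((isZero_zero C).of_iso Subobject.botCoeIsoZero)
      | succ i ih =>
        exact .step _ _ _ (shortExact_cokernel _) (ih (by omega)) (h i (by omega))
    have h1 := key n le_rfl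
    rw [hn] at h1
    exact h1.of_iso (asIso (⊤ : Subobject M).arrow)
  · intro hM
    induction hM with
    | @zero M hM =>
      have := Subobject.subsingleton_of_isZero hM
      exact ⟨0, fun _ => ⊥, monotone_const, rfl, Subsingleton.elim _ _, by simp⟩
    | @step X Y Z f g w h _ hZ ih =>
      obtain ⟨n, F, hF, h₀, hn, hq⟩ := ih
      have : Mono f := h.mono_f
      -- The filtration of $X$ is pushed into $Y$ and completed by one step. `F` may be arbitrary
      -- beyond `n`, so it is cut off there.
      let G : ℕ → Subobject Y := fun i => if i ≤ n then (Subobject.map f).obj (F i) else ⊤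
      have hG : Monotone G := by
        intro i j hij
        by_cases hj : j ≤ n
        · simp only [G, hj, hij.trans hj, if_true]
          exact (Subobject.map f).monotone (hF hij)
        · simp [G, hj]
      refine ⟨n + 1, G, hG, by simp [G, h₀, Subobject.map_bot], by simp [G], fun i hi => ?_⟩
      rcases (Nat.lt_succ_iff.1 hi).lt_or_eq with hi | rfl
      · have hmap : ∀ j, (Subobject.map f).obj (F j) = Subobject.mk ((F j).arrow ≫ f) := fun j => by
          rw [← Subobject.map_mk, Subobject.mk_arrow]
        refine prop_cokernel_ofLE (α := (F i).arrow ≫ f) (β := (F (i + 1)).arrow ≫ f)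
          (by simp [G, hi.le, hmap]) (by simp [G, Nat.succ_le_of_lt hi, hmap])
          (u := (F i).ofLE (F (i + 1)) (hF i.le_succ)) (by simp) _ (hq i hi)
      · refine prop_cokernel_ofLE (α := f) (β := 𝟙 Y) (by simp [G, hn, Subobject.map_top])
          (by simp [G, Subobject.top_eq_id])
          (u := f) (by simp) _ (P.prop_of_iso (cokernelIsoOfShortExact h).symm hZ)

end Filtrations

/-! ### Torsion pairs and the existence of bricks. -/

section Torsion

variable {C : Type u} [Category.{v} C] [Abelian C]

theorem isZero_image_iff {X Y : C} (f : X ⟶ Y) : IsZero (image f) ↔ f = 0 := by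
  constructor
  · intro h
    rw [← image.fac f, h.eq_zero_of_src (image.ι f), comp_zero]
  · rintro rfl
    exact (isZero_zero C).of_iso imageZero

theorem factorThruImage_comp_eq_zero_iff {X Y Z : C} (f : X ⟶ Y) (g : Z ⟶ image f) :
    g ≫ image.ι f = 0 ↔ g = 0 := by
  rw [← cancel_mono (image.ι f), zero_comp]

namespace IsTorsionClass

variable {P : ObjectProperty C}

theorem of_epi (hP : IsTorsionClass P) {X Y : C} (f : X ⟶ Y) [Epi f] (h : P X) : P Y :=
  have := hP.quotients
  P.prop_of_epi f h

theorem of_iso (hP : IsTorsionClass P) {X Y : C} (e : X ≅ Y) (h : P X) : P Y :=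
  hP.of_epi e.hom h

theorem of_isZero (hP : IsTorsionClass P) {X : C} (hX : IsZero X) : P X :=
  have := hP.containsZero
  have := hP.quotients
  P.prop_of_isZero hX

theorem image (hP : IsTorsionClass P) {X Y : C} (f : X ⟶ Y) (h : P X) : P (image f) :=
  hP.of_epi (factorThruImage f) h

theorem of_shortExact (hP : IsTorsionClass P) {X Y Z : C} {f : X ⟶ Y} {g : Y ⟶ Z}
    {w : f ≫ g = 0} (h : (ShortComplex.mk f g w).ShortExact) (hX : P X) (hZ : P Z) : P Y :=
  have := hP.extensions
  P.prop_X₂_of_shortExact h hX hZ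

theorem filtBy_le (hP : IsTorsionClass P) {Q : ObjectProperty C} (h : Q ≤ P) : FiltBy Q ≤ P := by
  intro M hM
  induction hM with
  | zero h => exact hP.of_isZero h
  | step f g w h' _ hZ ih => exact hP.of_shortExact h' ih (h _ hZ)

end IsTorsionClass

theorem torsClosure_le_iff {P : ObjectProperty C} {T : Tors C} :
    torsClosure P ≤ T ↔ P ≤ T.1 :=
  ⟨fun h M hM => h M fun _ hU => hU M hM, fun h => sInf_le (a := T) h⟩

theorem le_torsClosure (P : ObjectProperty C) : P ≤ (torsClosure P).1 :=
  torsClosure_le_iff.1 le_rfl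

theorem torsClosure_mono {P Q : ObjectProperty C} (h : P ≤ Q) : torsClosure P ≤ torsClosure Q :=
  torsClosure_le_iff.2 (h.trans (le_torsClosure Q))

theorem leftPerp_anti {P Q : ObjectProperty C} (h : P ≤ Q) : leftPerp Q ≤ leftPerp P :=
  fun _ hM _ f hY => hM f (h _ hY)

omit [Abelian C] in
theorem isoClass_self (B : C) : isoClass B B := ⟨Iso.refl B⟩

theorem isoClass_le_iff {T : Tors C} {B : C} : isoClass B ≤ T.1 ↔ T.1 B :=
  ⟨fun h => h B (isoClass_self B), fun h _ ⟨e⟩ => T.2.of_iso e.symm h⟩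

theorem torsClosure_isoClass_le_iff {T : Tors C} {B : C} :
    torsClosure (isoClass B) ≤ T ↔ T.1 B :=
  torsClosure_le_iff.trans isoClass_le_iff

theorem torsClosure_isoClass_self (B : C) : (torsClosure (isoClass B)).1 B :=
  torsClosure_isoClass_le_iff.1 le_rfl

theorem leftPerp_isoClass_iff {M B : C} : (leftPerp (isoClass B)).1 M ↔ ∀ f : M ⟶ B, f = 0 :=
  ⟨fun h f => h f (isoClass_self B), fun h Y f ⟨e⟩ => by
    rw [← cancel_mono e.hom, zero_comp]
    exact h _⟩

theorem leftPerp_iff_forall {P : ObjectProperty C} {M : C} :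
    (leftPerp P).1 M ↔ ∀ B, P B → (leftPerp (isoClass B)).1 M :=
  ⟨fun h _ hB => leftPerp_isoClass_iff.2 fun f => h f hB,
    fun h B f hB => leftPerp_isoClass_iff.1 (h B hB) f⟩

theorem leftPerp_eq_sInf (P : ObjectProperty C) :
    leftPerp P = sInf {T | ∃ B, P B ∧ T = leftPerp (isoClass B)} :=
  le_antisymm (le_sInf fun _ ⟨_, hB, h⟩ => h ▸ fun _ hM => leftPerp_iff_forall.1 hM _ hB)
    fun _ hM => leftPerp_iff_forall.2 fun B hB => hM _ ⟨B, hB, rfl⟩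

theorem torsClosure_eq_sSup (P : ObjectProperty C) :
    torsClosure P = sSup {T | ∃ B, P B ∧ T = torsClosure (isoClass B)} :=
  le_antisymm (torsClosure_le_iff.2 fun B hB =>
      torsClosure_isoClass_le_iff.1 (le_sSup ⟨B, hB, rfl⟩))
    (sSup_le fun _ ⟨_, hB, h⟩ => h ▸ torsClosure_isoClass_le_iff.2 (le_torsClosure P _ hB))

/-- A nonzero object of `T(P)` receives a nonzero map from an object of `P`. -/
theorem exists_ne_zero_of_torsClosure {P : ObjectProperty C} {M : C} (hM : (torsClosure P).1 M)
    (h0 : ¬ IsZero M) : ∃ B, P B ∧ ∃ f : B ⟶ M, f ≠ 0 := by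
  by_contra! h
  have h1 : torsClosure P ≤ leftPerp (isoClass M) :=
    torsClosure_le_iff.2 fun B hB => leftPerp_isoClass_iff.2 fun f => h B hB f
  exact h0 ((IsZero.iff_id_eq_zero M).2 (leftPerp_isoClass_iff.1 (h1 M hM) _))

theorem rightOrthogonal_of_mono {P : ObjectProperty C} {M N : C} (i : M ⟶ N) [Mono i]
    (h : P.rightOrthogonal N) : P.rightOrthogonal M := fun X f hX => by
  rw [← cancel_mono i, zero_comp]
  exact h _ hX

/-- An object not in the torsion class `T` has a nonzero quotient in the torsion-free class
of `T`. -/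
theorem exists_epi_rightOrthogonal (hC : IsLengthCategory C) (T : Tors C) {M : C}
    (hM : ¬ T.1 M) : ∃ (N : C) (f : M ⟶ N), Epi f ∧ ¬ IsZero N ∧ T.1.rightOrthogonal N := by
  have := hC.wellFoundedGT M
  -- A maximal subobject in $T$; it remains to see that $M/P$ is torsion-free.
  obtain ⟨P, hP, hmax⟩ := (wellFounded_gt (α := Subobject M)).has_min
    {P : Subobject M | T.1 (P : C)}
    ⟨⊥, T.2.of_isZero ((isZero_zero C).of_iso Subobject.botCoeIsoZero)⟩
  refine ⟨cokernel P.arrow, cokernel.π _, inferInstance, fun h => hM ?_, fun X f hX => ?_⟩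
  · have : Epi P.arrow := Preadditive.epi_of_isZero_cokernel _ h
    exact T.2.of_epi P.arrow hP
  -- This kernel is the preimage in $M$ of the image of `f`. It is an extension of that image by
  -- $P$, hence in $T$, hence equal to $P$ by maximality, so `f` vanishes.
  · obtain ⟨a, b, w, h⟩ := shortExact_kernel_comp_of_epi (cokernel.π P.arrow) (cokernel.π f)
    have hQ : T.1 (kernel (cokernel.π P.arrow ≫ cokernel.π f)) := by
      refine T.2.of_shortExact h (T.2.of_iso ?_ hP) (T.2.of_iso ?_ (T.2.image f hX))
      · exact (kernelIsoOfShortExact (shortExact_cokernel P.arrow)).symm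
      · exact (Abelian.imageIsoImage f).symm
    have hle : P ≤ Subobject.mk (kernel.ι (cokernel.π P.arrow ≫ cokernel.π f)) :=
      Subobject.le_mk_of_comm (kernel.lift _ P.arrow (by simp)) (by simp)
    have hge : Subobject.mk (kernel.ι (cokernel.π P.arrow ≫ cokernel.π f)) ≤ P := by
      by_contra hn
      exact hmax _ (T.2.of_iso (Subobject.underlyingIso _).symm hQ) (lt_of_le_not_ge hle hn)
    have hz : kernel.ι (cokernel.π P.arrow ≫ cokernel.π f) ≫ cokernel.π P.arrow = 0 := by
      rw [← Subobject.ofMkLE_arrow hge, Category.assoc, cokernel.condition, comp_zero]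
    obtain ⟨A, π, hπ, x, hx⟩ := surjective_up_to_refinements_of_epi (cokernel.π P.arrow) f
    have hx0 : x ≫ cokernel.π P.arrow ≫ cokernel.π f = 0 := by
      rw [← reassoc_of% hx, cokernel.condition, comp_zero]
    rw [← cancel_epi π, hx, ← kernel.lift_ι _ x hx0, Category.assoc, hz, comp_zero, comp_zero]

theorem mem_of_leftOrthogonal_rightOrthogonal (hC : IsLengthCategory C) (T : Tors C) {M : C}
    (h : ∀ N, T.1.rightOrthogonal N → ∀ f : M ⟶ N, f = 0) : T.1 M := by
  by_contra hM
  obtain ⟨N, f, hf, hN, hT⟩ := exists_epi_rightOrthogonal hC T hM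
  exact hN (IsZero.of_epi_eq_zero f (h N hT f))

/-- If `T ≰ U`, there is a brick in `T` that is torsion-free with respect to `U`. -/
theorem exists_brick_of_not_le (hC : IsLengthCategory C) {T U : Tors C} (h : ¬ T ≤ U) :
    ∃ B, IsBrick B ∧ T.1 B ∧ U.1.rightOrthogonal B := by
  obtain ⟨M, hMT, hMU⟩ : ∃ M, T.1 M ∧ ¬ U.1 M := by
    by_contra! h'
    exact h h'
  obtain ⟨N, f, hf, hN, hNU⟩ := exists_epi_rightOrthogonal hC U hMU
  have := hC.wellFoundedLT N
  -- A minimal non-zero subobject in $T$ is a brick: a non-zero endomorphism has its image in $T$,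
  -- so it is epi by minimality and iso by finite length.
  obtain ⟨I, ⟨hI, hI0⟩, hmin⟩ := (wellFounded_lt (α := Subobject N)).has_min
    {I : Subobject N | T.1 (I : C) ∧ ¬ IsZero (I : C)}
    ⟨⊤, T.2.of_iso (asIso (⊤ : Subobject N).arrow).symm (T.2.of_epi f hMT),
      fun h => hN (h.of_iso (asIso (⊤ : Subobject N).arrow).symm)⟩
  refine ⟨I, ⟨?_, fun f hf => ?_⟩, hI, rightOrthogonal_of_mono I.arrow hNU⟩
  · exact ⟨⟨𝟙 _, 0, fun h => hI0 ((IsZero.iff_id_eq_zero _).2 h)⟩⟩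
  · have hle : Subobject.mk (image.ι f ≫ I.arrow) ≤ I := Subobject.mk_le_of_comm (image.ι f) rfl
    have hmem : T.1 (Subobject.mk (image.ι f ≫ I.arrow) : C) ∧
        ¬ IsZero (Subobject.mk (image.ι f ≫ I.arrow) : C) :=
      ⟨T.2.of_iso (Subobject.underlyingIso _).symm (T.2.image f hI), fun h => hf
        ((isZero_image_iff f).1 (h.of_iso (Subobject.underlyingIso _).symm))⟩
    have hge : I ≤ Subobject.mk (image.ι f ≫ I.arrow) := by
      by_contra hn
      exact hmin _ hmem (lt_of_le_not_ge hle hn)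
    have hι : Epi (image.ι f) := by
      have h1 : Subobject.ofLEMk I (image.ι f ≫ I.arrow) hge ≫ image.ι f = 𝟙 _ := by
        rw [← cancel_mono I.arrow]
        simp
      exact epi_of_epi_fac h1
    have : Epi f := by
      rw [← image.fac f]
      exact epi_comp _ _
    have := hC.wellFoundedGT (I : C)
    have : IsIso (f : (I : C) ⟶ I) := isIso_of_epi_endo f
    exact (isUnit_iff_isIso f).2 this

end Torsion

/-! ### Maps into and out of semibricks. -/

section Semibricks

variable {C : Type u} [Category.{v} C] [Abelian C]

theorem IsBrick.isIso {B : C} (hB : IsBrick B) {f : B ⟶ B} (hf : f ≠ 0) : IsIso f :=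
  (isUnit_iff_isIso f).1 (hB.2 f hf)

theorem IsBrick.id_ne_zero {B : C} (hB : IsBrick B) : 𝟙 B ≠ 0 := fun h => by
  have := hB.1
  exact one_ne_zero (α := End B) h

theorem IsBrick.not_isZero {B : C} (hB : IsBrick B) : ¬ IsZero B := fun h =>
  hB.id_ne_zero ((IsZero.iff_id_eq_zero B).1 h)

theorem IsBrick.of_iso {B B' : C} (hB : IsBrick B) (e : B ≅ B') : IsBrick B' := by
  refine ⟨⟨𝟙 _, 0, fun h => hB.not_isZero (((IsZero.iff_id_eq_zero B').2 h).of_iso e)⟩,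
    fun f hf => (isUnit_iff_isIso f).2 ?_⟩
  have : IsIso (e.hom ≫ (f : B' ⟶ B') ≫ e.inv) := hB.isIso fun h => hf (by
    have h1 : (f : B' ⟶ B') = e.inv ≫ (e.hom ≫ (f : B' ⟶ B') ≫ e.inv) ≫ e.hom := by simp
    rw [h] at h1
    simpa using h1)
  have h2 : (f : B' ⟶ B') = e.inv ≫ (e.hom ≫ (f : B' ⟶ B') ≫ e.inv) ≫ e.hom := by simp
  rw [h2]
  infer_instance

variable {S : ObjectProperty C}

theorem isIso_of_mem_sbrick (hS : S ∈ sbrick C) {B₁ B₂ : C} (h₁ : S B₁) (h₂ : S B₂)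
    {f : B₁ ⟶ B₂} (hf : f ≠ 0) : IsIso f := by
  obtain ⟨e⟩ : Nonempty (B₁ ≅ B₂) := by
    by_contra h
    exact hf (hS.2.2 B₁ B₂ h₁ h₂ h f)
  have : IsIso (f ≫ e.inv) := (hS.2.1 B₁ h₁).isIso fun h => hf (by
    rw [← cancel_mono e.inv, h, zero_comp])
  exact IsIso.of_isIso_comp_right f e.inv

theorem isoClass_mem_sbrick {B : C} (hB : IsBrick B) : isoClass B ∈ sbrick C :=
  ⟨⟨fun e ⟨e'⟩ => ⟨e.symm ≪≫ e'⟩⟩, fun _ ⟨e⟩ => hB.of_iso e.symm,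
    fun _ _ ⟨e₁⟩ ⟨e₂⟩ h => absurd ⟨e₁ ≪≫ e₂.symm⟩ h⟩

/-- Maps from `T(S)` to a member of the semibrick `S` are zero or epimorphisms. -/
theorem epi_of_torsClosure (hS : S ∈ sbrick C) {M B : C} (hM : (torsClosure S).1 M) (hB : S B)
    {f : M ⟶ B} (hf : f ≠ 0) : Epi f := by
  -- The image of `f` lies in $T(S)$, so it receives a non-zero map from $S$; composed into $B$ this
  -- is an isomorphism, whence `image.ι f` is epi.
  obtain ⟨B', hB', g, hg⟩ := exists_ne_zero_of_torsClosure ((torsClosure S).2.image f hM)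
    fun h => hf ((isZero_image_iff f).1 h)
  have : IsIso (g ≫ image.ι f) := isIso_of_mem_sbrick hS hB' hB
    fun h => hg ((factorThruImage_comp_eq_zero_iff f g).1 h)
  have : Epi (image.ι f) := epi_of_epi g _
  rw [← image.fac f]
  exact epi_comp _ _

/-- Maps from a member of the semibrick `S` to the torsion-free closure of `S` are zero or
monomorphisms. -/
theorem mono_of_rightOrthogonal_leftPerp (hS : S ∈ sbrick C) {N B : C}
    (hN : (leftPerp S).1.rightOrthogonal N) (hB : S B) {f : B ⟶ N} (hf : f ≠ 0) : Mono f := by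
  obtain ⟨B', g, hB', hg⟩ : ∃ B', ∃ g : image f ⟶ B', S B' ∧ g ≠ 0 := by
    by_contra! h
    have h1 : (leftPerp S).1 (image f) := fun B' g hB' => h B' g hB'
    exact hf (by rw [← image.fac f, hN (image.ι f) h1, comp_zero])
  have : IsIso (factorThruImage f ≫ g) := isIso_of_mem_sbrick hS hB hB'
    fun h => hg (by rw [← cancel_epi (factorThruImage f), h, comp_zero])
  have : Mono (factorThruImage f) := mono_of_mono _ g
  rw [← image.fac f]
  exact mono_comp _ _

/-- A non-zero map from an object of $T$ to $B$ is epi and would make $B$ a quotient of that object.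
This dichotomy gives canonicity of joins. -/
theorem torsClosure_le_or_leftPerp (hS : S ∈ sbrick C) {B : C} (hB : S B) {T : Tors C}
    (hT : T ≤ torsClosure S) (h : ¬ T.1 B) : T ≤ leftPerp (isoClass B) := fun M hM =>
  leftPerp_isoClass_iff.2 fun f => by
    by_contra hf
    have := epi_of_torsClosure hS (hT M hM) hB hf
    exact h (T.2.of_epi f hM)

/-- The dual dichotomy: a non-zero map from $B$ to a $T$-torsion-free object would be mono, and
would stay non-zero after composition with a non-zero $M\to B$, $M\in T$. So
$B\in{}^\perp(T^\perp)=T$. -/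
theorem mem_of_leftPerp_le (hC : IsLengthCategory C) (hS : S ∈ sbrick C) {B : C} (hB : S B)
    {T : Tors C} (hT : leftPerp S ≤ T) (h : ¬ T ≤ leftPerp (isoClass B)) : T.1 B := by
  obtain ⟨M, hM, f, hf⟩ : ∃ M, T.1 M ∧ ∃ f : M ⟶ B, f ≠ 0 := by
    by_contra! h'
    exact h fun M hM => leftPerp_isoClass_iff.2 (h' M hM)
  refine mem_of_leftOrthogonal_rightOrthogonal hC T fun N hN g => ?_
  by_contra hg
  have := mono_of_rightOrthogonal_leftPerp hS (fun X k hX => hN k (hT X hX)) hB hg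
  exact hf (by rw [← cancel_mono g, zero_comp, hN (f ≫ g) hM])

/-- There are epimorphisms both ways; their composite is a non-zero endomorphism of a brick, hence
invertible. -/
theorem iso_of_torsClosure_eq {B₁ B₂ : C} (h₁ : IsBrick B₁) (h₂ : IsBrick B₂)
    (h : torsClosure (isoClass B₁) = torsClosure (isoClass B₂)) : Nonempty (B₁ ≅ B₂) := by
  obtain ⟨B, ⟨e⟩, f, hf⟩ := exists_ne_zero_of_torsClosure
    (h ▸ torsClosure_isoClass_self B₁ : (torsClosure (isoClass B₂)).1 B₁) h₁.not_isZero
  obtain ⟨B', ⟨e'⟩, f', hf'⟩ := exists_ne_zero_of_torsClosure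
    (h ▸ torsClosure_isoClass_self B₂ : (torsClosure (isoClass B₁)).1 B₂) h₂.not_isZero
  have hg : e.inv ≫ f ≠ 0 := fun h => hf (by rw [← cancel_epi e.inv, h, comp_zero])
  have hg' : e'.inv ≫ f' ≠ 0 := fun h => hf' (by rw [← cancel_epi e'.inv, h, comp_zero])
  have : Epi (e.inv ≫ f) := epi_of_torsClosure (isoClass_mem_sbrick h₁)
    (h ▸ torsClosure_isoClass_self B₂) (isoClass_self B₁) hg
  have : Epi (e'.inv ≫ f') := epi_of_torsClosure (isoClass_mem_sbrick h₂)
    (h ▸ torsClosure_isoClass_self B₁) (isoClass_self B₂) hg'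
  have : IsIso ((e'.inv ≫ f') ≫ e.inv ≫ f) := h₁.isIso fun h => h₁.not_isZero
    (IsZero.of_epi_eq_zero _ h)
  have : Mono (e'.inv ≫ f') := mono_of_mono _ (e.inv ≫ f)
  have := isIso_of_mono_of_epi (e'.inv ≫ f')
  exact ⟨asIso (e'.inv ≫ f')⟩

theorem iso_of_leftPerp_eq {B₁ B₂ : C} (h₁ : IsBrick B₁) (h₂ : IsBrick B₂)
    (h : leftPerp (isoClass B₁) = leftPerp (isoClass B₂)) : Nonempty (B₁ ≅ B₂) := by
  have hne : ∀ {A B : C}, IsBrick A → leftPerp (isoClass A) = leftPerp (isoClass B) →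
      ∃ f : A ⟶ B, f ≠ 0 := by
    intro A B hA h
    by_contra! h'
    exact hA.id_ne_zero (leftPerp_isoClass_iff.1 (h ▸ leftPerp_isoClass_iff.2 h') _)
  have hmem : ∀ B : C, (leftPerp (isoClass B)).1.rightOrthogonal B := fun B _ f hX =>
    leftPerp_isoClass_iff.1 hX f
  obtain ⟨f, hf⟩ := hne h₁ h
  obtain ⟨g, hg⟩ := hne h₂ h.symm
  have : Mono f := mono_of_rightOrthogonal_leftPerp (isoClass_mem_sbrick h₁)
    (h ▸ hmem B₂) (isoClass_self B₁) hf
  have : Mono g := mono_of_rightOrthogonal_leftPerp (isoClass_mem_sbrick h₂)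
    (h ▸ hmem B₁) (isoClass_self B₂) hg
  have : IsIso (g ≫ f) := h₂.isIso fun h => h₂.not_isZero (IsZero.of_mono_eq_zero _ h)
  have : Epi f := epi_of_epi g f
  have := isIso_of_mono_of_epi f
  exact ⟨asIso f⟩

end Semibricks

/-! ### Irreducible elements and the kappa map. -/

section Lattice

variable {L : Type*} [CompleteLattice L]

theorem IsCompletelyJoinIrreducible.lowerStar_lt {j : L} (hj : IsCompletelyJoinIrreducible j) :
    lowerStar j < j :=
  lt_of_le_of_ne (sSup_le fun _ h => h.le) fun h => lt_irrefl j (hj {x | x < j} h.symm)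

/-- Members of a canonical meet representation are completely meet-irreducible. -/
theorem IsCanonicalMeetRep.irreducible {x : L} {A : Set L} (hA : IsCanonicalMeetRep x A) {a : L}
    (ha : a ∈ A) {B : Set L} (hB : a = sInf B) : a ∈ B := by
  have hx : x = sInf (B ∪ (A \ {a})) := by
    rw [sInf_union, ← hB, ← sInf_insert, Set.insert_sdiff_singleton, Set.insert_eq_of_mem ha]
    exact hA.eq_sInf
  obtain ⟨b, hb | hb, hab⟩ := hA.refines _ hx a ha
  · rwa [le_antisymm (hB ▸ sInf_le hb) hab]
  · exact absurd (hA.antichain b hb.1 a ha hab) hb.2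

end Lattice

section Kappa

variable {C : Type u} [Category.{v} C] [Abelian C]

theorem Tors.inf_iff {T U : Tors C} {M : C} : (T ⊓ U).1 M ↔ T.1 M ∧ U.1 M := by
  refine ⟨fun h => ⟨(inf_le_left : T ⊓ U ≤ T) M h, (inf_le_right : T ⊓ U ≤ U) M h⟩, fun h => ?_⟩
  exact torsClosure_isoClass_le_iff.1
    (le_inf (torsClosure_isoClass_le_iff.2 h.1) (torsClosure_isoClass_le_iff.2 h.2))

theorem IsBrick.not_leftPerp {B : C} (hB : IsBrick B) : ¬ (leftPerp (isoClass B)).1 B := fun h =>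
  hB.id_ne_zero (leftPerp_isoClass_iff.1 h _)

theorem lt_torsClosure_iff {B : C} (hB : IsBrick B) {T : Tors C} :
    T < torsClosure (isoClass B) ↔ T ≤ torsClosure (isoClass B) ⊓ leftPerp (isoClass B) := by
  constructor
  · intro h
    exact le_inf h.le (torsClosure_le_or_leftPerp (isoClass_mem_sbrick hB) (isoClass_self B) h.le
      fun hT => h.not_ge (torsClosure_isoClass_le_iff.2 hT))
  · intro h
    exact lt_of_le_of_ne (h.trans inf_le_left) fun he => hB.not_leftPerp
      ((he ▸ h).trans inf_le_right B (torsClosure_isoClass_self B))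

theorem lowerStar_torsClosure {B : C} (hB : IsBrick B) : lowerStar (torsClosure (isoClass B)) =
    torsClosure (isoClass B) ⊓ leftPerp (isoClass B) :=
  le_antisymm (sSup_le fun _ h => (lt_torsClosure_iff hB).1 h)
    (le_sSup ((lt_torsClosure_iff hB).2 le_rfl))

/-- A non-zero map $\operatorname{coker} i\to B$ would give an automorphism of $B$ killing `i`. -/
theorem cokernel_mem_lowerStar {B I : C} (hB : IsBrick B) {i : I ⟶ B} (hi : i ≠ 0) :
    (lowerStar (torsClosure (isoClass B))).1 (cokernel i) := by
  rw [lowerStar_torsClosure hB, Tors.inf_iff]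
  refine ⟨(torsClosure _).2.of_epi (cokernel.π i) (torsClosure_isoClass_self B),
    leftPerp_isoClass_iff.2 fun f => ?_⟩
  rw [← cancel_epi (cokernel.π i), comp_zero]
  by_contra h
  have := hB.isIso h
  refine hi ?_
  rw [← cancel_mono (cokernel.π i ≫ f), zero_comp, cokernel.condition_assoc, zero_comp]

/-- If $M\in x$ has a non-zero map to $B$, then $B$ is an extension of a proper quotient, in
$T(B)_*\le x$, by the image, in $x$. So $B\in T(B)\wedge x=T(B)_*\le{}^\perp B$, which is absurd. -/
theorem isGreatest_leftPerp {B : C} (hB : IsBrick B) :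
    IsGreatest {x : Tors C | torsClosure (isoClass B) ⊓ x = lowerStar (torsClosure (isoClass B))}
      (leftPerp (isoClass B)) := by
  refine ⟨(lowerStar_torsClosure hB).symm, fun x hx M hM => leftPerp_isoClass_iff.2 fun f => ?_⟩
  by_contra hf
  have hι : image.ι f ≠ 0 := fun h => hf (by rw [← image.fac f, h, comp_zero])
  have hc : x.1 (cokernel (image.ι f)) :=
    (hx.ge.trans inf_le_right : lowerStar _ ≤ x) _ (cokernel_mem_lowerStar hB hι)
  have hxB : x.1 B := x.2.of_shortExact (shortExact_cokernel (image.ι f)) (x.2.image f hM) hc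
  have h1 : (lowerStar (torsClosure (isoClass B))).1 B := by
    rw [← hx]
    exact Tors.inf_iff.2 ⟨torsClosure_isoClass_self B, hxB⟩
  rw [lowerStar_torsClosure hB] at h1
  exact hB.not_leftPerp (Tors.inf_iff.1 h1).2

theorem kappa_torsClosure {B : C} (hB : IsBrick B) :
    kappa (torsClosure (isoClass B)) = leftPerp (isoClass B) :=
  (isGreatest_leftPerp hB).isLUB.sSup_eq

/-- A brick $B\in j$ that is torsion-free for $j_*$ generates $j$: otherwise $T(B)<j$ would put $B$
in $j_*$. -/
theorem exists_brick_of_joinIrreducible (hC : IsLengthCategory C) {j : Tors C}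
    (hj : IsCompletelyJoinIrreducible j) : ∃ B, IsBrick B ∧ j = torsClosure (isoClass B) := by
  obtain ⟨B, hB, hjB, hBs⟩ := exists_brick_of_not_le hC hj.lowerStar_lt.not_ge
  refine ⟨B, hB, (eq_of_le_of_not_lt (torsClosure_isoClass_le_iff.2 hjB) fun h => ?_).symm⟩
  have hle : torsClosure (isoClass B) ≤ lowerStar j := le_sSup (show _ ∈ {x | x < j} from h)
  exact hB.id_ne_zero (hBs _ (hle B (torsClosure_isoClass_self B)))

theorem exists_brick_of_meetIrreducible (hC : IsLengthCategory C) {m : Tors C}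
    (hm : ∀ X : Set (Tors C), m = sInf X → m ∈ X) :
    ∃ B, IsBrick B ∧ m = leftPerp (isoClass B) := by
  have hlt : ¬ sInf {x | m < x} ≤ m := fun h =>
    lt_irrefl m (hm {x | m < x} (le_antisymm (le_sInf fun _ h => h.le) h))
  obtain ⟨B, hB, hmB, hBm⟩ := exists_brick_of_not_le hC hlt
  have hle : m ≤ leftPerp (isoClass B) := fun M hM => leftPerp_isoClass_iff.2 fun f => hBm f hM
  exact ⟨B, hB, eq_of_le_of_not_lt hle fun h => hB.not_leftPerp
    ((sInf_le (show _ ∈ {x | m < x} from h) : sInf {x | m < x} ≤ _) B hmB)⟩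

end Kappa

/-! ### Canonical representations and semibricks. -/

section CanonicalRepresentations

variable {C : Type u} [Category.{v} C] [Abelian C] {S : ObjectProperty C}

theorem isCanonicalJoinRep_torsClosure (hS : S ∈ sbrick C) : IsCanonicalJoinRep (torsClosure S)
    {T | ∃ B, S B ∧ T = torsClosure (isoClass B)} where
  eq_sSup := torsClosure_eq_sSup S
  refines := by
    rintro X hX _ ⟨B, hB, rfl⟩
    by_contra! h
    -- If no joinand contains $B$, the dichotomy puts all of them in ${}^\perp B$.
    have h1 : torsClosure S ≤ leftPerp (isoClass B) := by
      conv_lhs => rw [hX]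
      refine sSup_le fun T hT => torsClosure_le_or_leftPerp hS hB ?_ fun hTB =>
        h T hT (torsClosure_isoClass_le_iff.2 hTB)
      rw [hX]
      exact le_sSup hT
    exact (hS.2.1 B hB).not_leftPerp (h1 B (le_torsClosure S B hB))
  antichain := by
    rintro _ ⟨B₁, hB₁, rfl⟩ _ ⟨B₂, hB₂, rfl⟩ h
    obtain ⟨B, ⟨e⟩, f, hf⟩ := exists_ne_zero_of_torsClosure
      (torsClosure_isoClass_le_iff.1 h) (hS.2.1 B₁ hB₁).not_isZero
    have : IsIso f := isIso_of_mem_sbrick hS (hS.1.of_iso e.symm hB₂) hB₁ hf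
    exact le_antisymm h (torsClosure_isoClass_le_iff.2
      ((torsClosure _).2.of_iso ((asIso f).symm ≪≫ e) (torsClosure_isoClass_self B₁)))

theorem isCanonicalMeetRep_leftPerp (hC : IsLengthCategory C) (hS : S ∈ sbrick C) :
    IsCanonicalMeetRep (leftPerp S) {T | ∃ B, S B ∧ T = leftPerp (isoClass B)} where
  eq_sInf := leftPerp_eq_sInf S
  refines := by
    rintro X hX _ ⟨B, hB, rfl⟩
    by_contra! h
    have h1 : (leftPerp S).1 B := by
      rw [hX]
      intro T hT
      refine mem_of_leftPerp_le hC hS hB ?_ (h T hT)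
      rw [hX]
      exact sInf_le hT
    exact (hS.2.1 B hB).id_ne_zero (h1 _ hB)
  antichain := by
    rintro _ ⟨B₁, hB₁, rfl⟩ _ ⟨B₂, hB₂, rfl⟩ h
    obtain ⟨f, hf⟩ : ∃ f : B₂ ⟶ B₁, f ≠ 0 := by
      by_contra! h'
      exact (hS.2.1 B₂ hB₂).not_leftPerp (h B₂ (leftPerp_isoClass_iff.2 h'))
    have : IsIso f := isIso_of_mem_sbrick hS hB₂ hB₁ hf
    refine le_antisymm h fun M hM => leftPerp_isoClass_iff.2 fun g => ?_
    rw [← cancel_mono (inv f), zero_comp]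
    exact leftPerp_isoClass_iff.1 hM _

theorem torsClosure_isoClass_congr {B₁ B₂ : C} (e : B₁ ≅ B₂) :
    torsClosure (isoClass B₁) = torsClosure (isoClass B₂) :=
  congrArg torsClosure (by ext X; exact ⟨fun ⟨i⟩ => ⟨i ≪≫ e⟩, fun ⟨i⟩ => ⟨i ≪≫ e.symm⟩⟩)

theorem leftPerp_isoClass_congr {B₁ B₂ : C} (e : B₁ ≅ B₂) :
    leftPerp (isoClass B₁) = leftPerp (isoClass B₂) :=
  congrArg leftPerp (by ext X; exact ⟨fun ⟨i⟩ => ⟨i ≪≫ e⟩, fun ⟨i⟩ => ⟨i ≪≫ e.symm⟩⟩)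

theorem cjrBricks_torsClosure (hS : S ∈ sbrick C) : cjrBricks (torsClosure S) = S := by
  ext B
  rw [cjrBricks, (isCanonicalJoinRep_torsClosure hS).cjr_eq]
  constructor
  · rintro ⟨hB, B', hB', h⟩
    obtain ⟨e⟩ := iso_of_torsClosure_eq hB (hS.2.1 B' hB') h
    exact hS.1.of_iso e.symm hB'
  · exact fun hB => ⟨hS.2.1 B hB, B, hB, rfl⟩

theorem cmrBricks_leftPerp (hC : IsLengthCategory C) (hS : S ∈ sbrick C) :
    cmrBricks (leftPerp S) = S := by
  ext B
  rw [cmrBricks, (isCanonicalMeetRep_leftPerp hC hS).cmr_eq]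
  constructor
  · rintro ⟨hB, B', hB', h⟩
    obtain ⟨e⟩ := iso_of_leftPerp_eq hB (hS.2.1 B' hB') h
    exact hS.1.of_iso e.symm hB'
  · exact fun hB => ⟨hS.2.1 B hB, B, hB, rfl⟩

theorem torsClosure_cjrBricks (hC : IsLengthCategory C) {T : Tors C}
    (hT : T ∈ lowerZero (Tors C)) : torsClosure (cjrBricks T) = T := by
  obtain ⟨A, hA⟩ := hT
  rw [torsClosure_eq_sSup]
  conv_rhs => rw [hA.eq_sSup]
  congr 1
  ext a
  simp only [cjrBricks, hA.cjr_eq, Set.mem_ofPred_eq]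
  constructor
  · rintro ⟨B, ⟨_, h⟩, rfl⟩
    exact h
  · intro ha
    obtain ⟨B, hB, rfl⟩ := exists_brick_of_joinIrreducible hC (hA.irreducible ha)
    exact ⟨B, ⟨hB, ha⟩, rfl⟩

theorem leftPerp_cmrBricks (hC : IsLengthCategory C) {T : Tors C}
    (hT : T ∈ upperZero (Tors C)) : leftPerp (cmrBricks T) = T := by
  obtain ⟨A, hA⟩ := hT
  rw [leftPerp_eq_sInf]
  conv_rhs => rw [hA.eq_sInf]
  congr 1
  ext a
  simp only [cmrBricks, hA.cmr_eq, Set.mem_ofPred_eq]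
  constructor
  · rintro ⟨B, ⟨_, h⟩, rfl⟩
    exact h
  · intro ha
    obtain ⟨B, hB, rfl⟩ := exists_brick_of_meetIrreducible hC fun _ h => hA.irreducible ha h
    exact ⟨B, ⟨hB, ha⟩, rfl⟩

theorem cjrBricks_mem_sbrick {T : Tors C} (hT : T ∈ lowerZero (Tors C)) :
    cjrBricks T ∈ sbrick C := by
  obtain ⟨A, hA⟩ := hT
  refine ⟨⟨fun e h => ⟨h.1.of_iso e, torsClosure_isoClass_congr e ▸ h.2⟩⟩, fun _ h => h.1, ?_⟩
  rintro B₁ B₂ ⟨h₁, hA₁⟩ ⟨h₂, hA₂⟩ hne f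
  rw [hA.cjr_eq] at hA₁ hA₂
  by_contra hf
  have hne' : torsClosure (isoClass B₁) ≠ torsClosure (isoClass B₂) := fun h =>
    hne (iso_of_torsClosure_eq h₁ h₂ h)
  have hlt : lowerStar (torsClosure (isoClass B₂)) < torsClosure (isoClass B₂) :=
    (hA.irreducible hA₂).lowerStar_lt
  have hι : image.ι f ≠ 0 := fun h => hf (by rw [← image.fac f, h, comp_zero])
  -- $B_2$ is an extension of the cokernel of $\operatorname{im} f\to B_2$, which lies in
  -- $T(B_2)_*$, by $\operatorname{im} f\in T(B_1)$.
  have hle : torsClosure (isoClass B₂) ≤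
      torsClosure (isoClass B₁) ⊔ lowerStar (torsClosure (isoClass B₂)) :=
    torsClosure_isoClass_le_iff.2 ((_ ⊔ _ : Tors C).2.of_shortExact
      (shortExact_cokernel (image.ι f))
      ((le_sup_left : torsClosure (isoClass B₁) ≤ _ ⊔ _) _
        ((torsClosure _).2.image f (torsClosure_isoClass_self B₁)))
      ((le_sup_right : lowerStar (torsClosure (isoClass B₂)) ≤ _ ⊔ _) _
        (cokernel_mem_lowerStar h₂ hι)))
  -- Hence $T(B_2)$ may be exchanged for the strictly smaller $T(B_2)_*$, which no canonical
  -- representation allows.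
  have hx : T = sSup (insert (lowerStar (torsClosure (isoClass B₂)))
      (A \ {torsClosure (isoClass B₂)})) := by
    refine le_antisymm ?_ (sSup_le ?_)
    · conv_lhs => rw [hA.eq_sSup]
      refine sSup_le fun a ha => ?_
      by_cases h : a = torsClosure (isoClass B₂)
      · rw [h]
        exact hle.trans (sup_le (le_sSup (Or.inr ⟨hA₁, hne'⟩)) (le_sSup (Or.inl rfl)))
      · exact le_sSup (Or.inr ⟨ha, h⟩)
    · rintro a (rfl | ha)
      · exact hlt.le.trans ((le_sSup hA₂).trans_eq hA.eq_sSup.symm)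
      · exact (le_sSup ha.1).trans_eq hA.eq_sSup.symm
  obtain ⟨b, rfl | hb, hab⟩ := hA.refines _ hx _ hA₂
  · exact hlt.not_ge hab
  · exact hb.2 (hA.antichain _ hA₂ b hb.1 hab).symm

theorem cmrBricks_mem_sbrick {T : Tors C} (hT : T ∈ upperZero (Tors C)) :
    cmrBricks T ∈ sbrick C := by
  obtain ⟨A, hA⟩ := hT
  refine ⟨⟨fun e h => ⟨h.1.of_iso e, leftPerp_isoClass_congr e ▸ h.2⟩⟩, fun _ h => h.1, ?_⟩
  rintro B₁ B₂ ⟨h₁, hA₁⟩ ⟨h₂, hA₂⟩ hne f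
  rw [hA.cmr_eq] at hA₁ hA₂
  by_contra hf
  have hne' : leftPerp (isoClass B₂) ≠ leftPerp (isoClass B₁) := fun h =>
    hne (iso_of_leftPerp_eq h₁ h₂ h.symm)
  -- The dual exchange: $U$ contains ${}^\perp B_1$ strictly, since $B_1\in U$, but may replace it
  -- because a map $M\to B_1$ with $M\in{}^\perp B_2$ factors through $\ker f$.
  let U : Tors C := leftPerp (isoClass (kernel f))
  have hle : U ⊓ leftPerp (isoClass B₂) ≤ leftPerp (isoClass B₁) := fun M hM =>
    leftPerp_isoClass_iff.2 fun g => by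
      rw [Tors.inf_iff] at hM
      rw [← kernel.lift_ι f g (leftPerp_isoClass_iff.1 hM.2 _),
        leftPerp_isoClass_iff.1 hM.1 (kernel.lift f g _), zero_comp]
  have hUle : leftPerp (isoClass B₁) ≤ U := fun M hM => leftPerp_isoClass_iff.2 fun g => by
    rw [← cancel_mono (kernel.ι f), zero_comp]
    exact leftPerp_isoClass_iff.1 hM _
  have hUB : U.1 B₁ := leftPerp_isoClass_iff.2 fun g => by
    by_contra hg
    have : IsIso (g ≫ kernel.ι f) := h₁.isIso fun h => hg (by
      rw [← cancel_mono (kernel.ι f), h, zero_comp])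
    exact hf (by rw [← cancel_epi (g ≫ kernel.ι f)]; simp)
  have hx : T = sInf (insert U (A \ {leftPerp (isoClass B₁)})) := by
    refine le_antisymm (le_sInf ?_) ?_
    · rintro a (rfl | ha)
      · exact (hA.eq_sInf.trans_le (sInf_le hA₁)).trans hUle
      · exact hA.eq_sInf.trans_le (sInf_le ha.1)
    · conv_rhs => rw [hA.eq_sInf]
      refine le_sInf fun a ha => ?_
      by_cases h : a = leftPerp (isoClass B₁)
      · rw [h]
        exact le_trans (b := U ⊓ leftPerp (isoClass B₂))
          (le_inf (sInf_le (Or.inl rfl)) (sInf_le (Or.inr ⟨hA₂, hne'⟩))) hle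
      · exact sInf_le (Or.inr ⟨ha, h⟩)
  obtain ⟨b, rfl | hb, hab⟩ := hA.refines _ hx _ hA₁
  · exact h₁.not_leftPerp (hab B₁ hUB)
  · exact hb.2 (hA.antichain b hb.1 _ hA₁ hab)

theorem extKappa_torsClosure (hS : S ∈ sbrick C) : extKappa (torsClosure S) = leftPerp S := by
  rw [extKappa, (isCanonicalJoinRep_torsClosure hS).cjr_eq, leftPerp_eq_sInf]
  congr 1
  ext T
  constructor
  · rintro ⟨_, ⟨B, hB, rfl⟩, rfl⟩
    exact ⟨B, hB, kappa_torsClosure (hS.2.1 B hB)⟩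
  · rintro ⟨B, hB, rfl⟩
    exact ⟨_, ⟨B, hB, rfl⟩, kappa_torsClosure (hS.2.1 B hB)⟩

end CanonicalRepresentations

/-! ### Wide subcategories and their simple objects. -/

section Wide

variable {C : Type u} [Category.{v} C] [Abelian C] {S : ObjectProperty C}

theorem filt_sbrick (hS : S ∈ sbrick C) : filt S = FiltBy S :=
  have := hS.1
  filt_eq_filtBy

/-- A nonzero map from a filtered object to a member of the semibrick is an epimorphism with
filtered kernel. -/
theorem FiltBy.epi_and_kernel (hS : S ∈ sbrick C) {M B : C} (hM : FiltBy S M) (hB : S B)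
    {f : M ⟶ B} (hf : f ≠ 0) : Epi f ∧ FiltBy S (kernel f) := by
  induction hM with
  | zero h => exact absurd (h.eq_zero_of_src f) hf
  | step i p w h hX hZ ih =>
    have : Mono i := h.mono_f
    -- Either `f` factors through the top factor by an isomorphism and has kernel $X$, or it is
    -- non-zero on $X$ and $\ker f$ is an extension of the top factor by $\ker(i\circ f)$, with the
    -- composite in diagrammatic order.
    by_cases hif : i ≫ f = 0
    · have : Epi p := h.epi_g
      obtain ⟨g, rfl⟩ : ∃ g, f = p ≫ g := ⟨h.exact.desc f hif, (h.exact.g_desc f hif).symm⟩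
      have : IsIso g := isIso_of_mem_sbrick hS hZ hB fun h => hf (by rw [h, comp_zero])
      exact ⟨epi_comp _ _, hX.of_iso ((kernelIsoOfShortExact h).symm ≪≫
        (kernelCompMono p g).symm)⟩
    · obtain ⟨he, hk⟩ := ih hif
      obtain ⟨a, b, w', h'⟩ := shortExact_kernel_comp_of_mono i f
      exact ⟨epi_of_epi i f, .step a b w' h' hk (hS.1.of_iso (cokernelIsoOfShortExact h).symm hZ)⟩

/-- Kernels and cokernels of maps between filtered objects are filtered. -/
theorem FiltBy.kernel_and_cokernel (hS : S ∈ sbrick C) {M N : C} (hM : FiltBy S M)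
    (hN : FiltBy S N) (f : M ⟶ N) : FiltBy S (kernel f) ∧ FiltBy S (cokernel f) := by
  induction hN generalizing M with
  | zero h =>
    obtain rfl : f = 0 := h.eq_zero_of_tgt f
    exact ⟨hM.of_iso kernelZeroIsoSource.symm, .of_iso (.zero h) cokernelZeroIsoTarget.symm⟩
  | step i p w h hX hZ ih =>
    have : Mono i := h.mono_f
    by_cases hfp : f ≫ p = 0
    · obtain ⟨g, rfl⟩ : ∃ g, f = g ≫ i := ⟨h.exact.lift f hfp, (h.exact.lift_f f hfp).symm⟩
      obtain ⟨hk, hc⟩ := ih hM g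
      obtain ⟨a, b, w', h'⟩ := shortExact_cokernel_comp_of_mono g i
      exact ⟨hk.of_iso (kernelCompMono g i).symm,
        .step a b w' h' hc (hS.1.of_iso (cokernelIsoOfShortExact h).symm hZ)⟩
    -- Now `f ≫ p` is epi with filtered kernel, so `f` can be traded for the induced map from that
    -- kernel to $\ker p\cong X$, whose target has a shorter filtration.
    · obtain ⟨he, hk⟩ := hM.epi_and_kernel hS hZ hfp
      obtain ⟨t, ⟨e₁⟩, ⟨e₂⟩⟩ := exists_kernel_map_of_epi_comp f p
      obtain ⟨h₁, h₂⟩ := ih hk (t ≫ (kernelIsoOfShortExact h).hom)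
      exact ⟨h₁.of_iso (kernelCompMono t _ ≪≫ e₁.symm),
        h₂.of_iso (cokernelCompIsIso t _ ≪≫ e₂.symm)⟩

theorem filtBy_mem_wide (hS : S ∈ sbrick C) : FiltBy S ∈ wide C := by
  refine ⟨inferInstance, ⟨0, isZero_zero C, .zero (isZero_zero C)⟩, ⟨fun h h₁ h₃ => .ext h h₁ h₃⟩,
    ⟨?_⟩, ⟨?_⟩⟩
  · rintro _ ⟨f, k, hk, hM, hN⟩
    exact (FiltBy.kernel_and_cokernel hS hM hN f).1.of_iso
      (IsLimit.conePointUniqueUpToIso (limit.isLimit _) hk)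
  · rintro _ ⟨f, k, hk, hM, hN⟩
    exact (FiltBy.kernel_and_cokernel hS hM hN f).2.of_iso
      (IsColimit.coconePointUniqueUpToIso (colimit.isColimit _) hk)

variable {W : ObjectProperty C}

/-- Simple objects of a wide subcategory, in terms of the ambient category. -/
theorem simpleObjects_iff (hW : W ∈ wide C) {X : C} : simpleObjects W X ↔
    W X ∧ ¬ IsZero X ∧ ∀ (Y : C) (f : Y ⟶ X), W Y → Mono f → f ≠ 0 → IsIso f := by
  obtain ⟨_, _, _, _, _⟩ := hW
  -- Kernels taken in the ambient category stay in $W$, so monomorphisms of $W$ are monomorphisms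
  -- there.
  have hmono : ∀ {X Y : W.FullSubcategory} (f : X ⟶ Y), Mono f → Mono f.hom := by
    intro X Y f hf
    refine Preadditive.mono_of_kernel_zero ?_
    let k : (⟨kernel f.hom, W.prop_kernel f.hom X.2 Y.2⟩ : W.FullSubcategory) ⟶ X :=
      ObjectProperty.homMk (kernel.ι f.hom)
    have : k = 0 := by
      rw [← cancel_mono f, zero_comp]
      ext
      exact kernel.condition f.hom
    exact congrArg (fun g => g.hom) this
  constructor
  · rintro ⟨h, hs⟩
    refine ⟨h, fun h0 => ?_, fun Y f hY hf h0 => ?_⟩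
    · apply id_nonzero (⟨X, h⟩ : W.FullSubcategory)
      ext
      exact h0.eq_of_src _ _
    · let g : (⟨Y, hY⟩ : W.FullSubcategory) ⟶ ⟨X, h⟩ := ObjectProperty.homMk f
      have : Mono g := W.ι.mono_of_mono_map (show Mono f from hf)
      have : IsIso g := isIso_of_mono_of_nonzero fun h => h0 (congrArg (fun g => g.hom) h)
      exact inferInstanceAs (IsIso (W.ι.map g))
  · rintro ⟨h, h0, hs⟩
    refine ⟨h, ⟨fun {Y} f hf => ⟨fun hi h' => ?_, fun h' => ?_⟩⟩⟩
    · subst h'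
      have h1 : IsIso (W.ι.map (0 : Y ⟶ ⟨X, h⟩)) := inferInstance
      have h2 : IsIso (0 : Y.obj ⟶ X) := h1
      exact h0 (IsZero.of_epi_eq_zero (0 : Y.obj ⟶ X) rfl)
    · have := hs Y.obj f.hom Y.2 (hmono f hf) fun h => h' (by ext; exact h)
      have : IsIso (W.ι.map f) := this
      exact isIso_of_reflects_iso f W.ι

theorem isIso_of_simpleObjects (hW : W ∈ wide C) {X Y : C} (hX : simpleObjects W X)
    (hY : simpleObjects W Y) {f : X ⟶ Y} (hf : f ≠ 0) : IsIso f := by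
  rw [simpleObjects_iff hW] at hX hY
  obtain ⟨_, _, _, _, _⟩ := hW
  have hk : kernel.ι f = 0 := by
    by_contra h
    have := hX.2.2 _ (kernel.ι f) (W.prop_kernel f hX.1 hY.1) inferInstance h
    exact hf (by rw [← cancel_epi (kernel.ι f), kernel.condition, comp_zero])
  have hm : Mono f := Preadditive.mono_of_kernel_zero hk
  exact hY.2.2 _ f hX.1 hm hf

theorem simpleObjects_of_iso (hW : W ∈ wide C) {X Y : C} (e : X ≅ Y) (hX : simpleObjects W X) :
    simpleObjects W Y := by
  rw [simpleObjects_iff hW] at hX ⊢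
  refine ⟨hW.1.of_iso e hX.1, fun h => hX.2.1 (h.of_iso e), fun Z f hZ hf h0 => ?_⟩
  have : IsIso (f ≫ e.inv) := hX.2.2 Z _ hZ (mono_comp _ _) fun h => h0 (by
    rw [← cancel_mono e.inv, h, zero_comp])
  exact IsIso.of_isIso_comp_right f e.inv

theorem simpleObjects_mem_sbrick (hW : W ∈ wide C) : simpleObjects W ∈ sbrick C := by
  refine ⟨⟨fun e h => simpleObjects_of_iso hW e h⟩, fun B hB => ⟨?_, fun f hf => ?_⟩,
    fun B₁ B₂ h₁ h₂ h f => ?_⟩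
  · exact ⟨𝟙 B, 0, fun h => ((simpleObjects_iff hW).1 hB).2.1 ((IsZero.iff_id_eq_zero B).2 h)⟩
  · exact (isUnit_iff_isIso f).2 (isIso_of_simpleObjects hW hB hB hf)
  · by_contra hf
    have := isIso_of_simpleObjects hW h₁ h₂ hf
    exact h ⟨asIso f⟩

theorem simpleObjects_filtBy (hS : S ∈ sbrick C) : simpleObjects (FiltBy S) = S := by
  have hW := filtBy_mem_wide hS
  ext B
  rw [simpleObjects_iff hW]
  constructor
  · rintro ⟨hB, h0, hs⟩
    cases hB with
    | zero h => exact absurd h h0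
    | step i p w h hX hZ =>
      have : Mono i := h.mono_f
      have : Epi p := h.epi_g
      by_cases hi : i = 0
      · have : Mono p := h.exact.mono_g hi
        have := isIso_of_mono_of_epi p
        exact hS.1.of_iso (asIso p).symm hZ
      · have := hs _ i hX inferInstance hi
        refine absurd (IsZero.of_epi_eq_zero p ?_) (hS.2.1 _ hZ).not_isZero
        rw [← cancel_epi i, w, comp_zero]
  · intro hB
    refine ⟨.of_prop hB, (hS.2.1 B hB).not_isZero, fun Y f hY hf h0 => ?_⟩
    have := (hY.epi_and_kernel hS hB h0).1
    exact isIso_of_mono_of_epi f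

/-- Below a non-zero subobject $P$ in $W$, a maximal proper subobject $Q$ in $W$ has a quotient
simple in $W$; well-founded induction on $P$ then filters $Q$. -/
theorem filtBy_simpleObjects (hC : IsLengthCategory C) (hW : W ∈ wide C) :
    FiltBy (simpleObjects W) = W := by
  have hsimp := fun X => simpleObjects_iff hW (X := X)
  obtain ⟨_, _, _, _, _⟩ := hW
  refine le_antisymm (FiltBy.le_of_extensions fun X hX => ((hsimp X).1 hX).1) fun M hM => ?_
  have key : ∀ P : Subobject M, W (P : C) → FiltBy (simpleObjects W) (P : C) := by
    have := hC.wellFoundedLT M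
    have := hC.wellFoundedGT M
    intro P
    induction P using WellFoundedLT.induction with
    | ind P ih =>
    intro hP
    by_cases h0 : IsZero (P : C)
    · exact .zero h0
    have hPbot : ⊥ < P := bot_lt_iff_ne_bot.2 fun h => h0 (by
      rw [h]
      exact (isZero_zero C).of_iso Subobject.botCoeIsoZero)
    obtain ⟨Q, ⟨hQP, hQ⟩, hmax⟩ := (wellFounded_gt (α := Subobject M)).has_min
      {Q : Subobject M | Q < P ∧ W (Q : C)}
      ⟨⊥, hPbot, W.prop_of_isZero ((isZero_zero C).of_iso Subobject.botCoeIsoZero)⟩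
    have hcW : W (cokernel (Q.ofLE P hQP.le)) := W.prop_cokernel _ hQ hP
    refine .step _ _ _ (shortExact_cokernel (Q.ofLE P hQP.le)) (ih Q hQP hQ)
      ((hsimp _).2 ⟨hcW, fun h => ?_, fun Y f hY hf hf0 => ?_⟩)
    · have : Epi (Q.ofLE P hQP.le) := Preadditive.epi_of_isZero_cokernel _ h
      have := isIso_of_mono_of_epi (Q.ofLE P hQP.le)
      refine hQP.not_ge (Subobject.le_of_comm (inv (Q.ofLE P hQP.le)) ?_)
      simp
    · let π := cokernel.π (Q.ofLE P hQP.le)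
      let c := π ≫ cokernel.π f
      -- `kernel c` is the preimage in $P$ of the image of $f$. By maximality of $Q$ it is $P$, and
      -- `f` is epi, or $Q$, and `f` is zero.
      have hK : W (kernel c) := W.prop_kernel c hP (W.prop_cokernel f hY hcW)
      let R : Subobject M := Subobject.mk (kernel.ι c ≫ P.arrow)
      have hQR : Q ≤ R := Subobject.le_mk_of_comm (kernel.lift c (Q.ofLE P hQP.le) (by
        simp [c, π])) (by simp)
      have hRP : R ≤ P := Subobject.mk_le_of_comm (kernel.ι c) rfl
      have hRW : W (R : C) := W.prop_of_iso (Subobject.underlyingIso _).symm hK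
      have hcases : R = P ∨ R = Q := by
        by_cases h : R = P
        · exact .inl h
        · refine .inr (eq_of_le_of_not_lt hQR fun hlt => ?_).symm
          exact hmax R ⟨lt_of_le_of_ne hRP h, hRW⟩ hlt
      rcases hcases with h | h
      · have hle : P ≤ Subobject.mk (kernel.ι c ≫ P.arrow) := h.ge
        have h1 : Subobject.ofLEMk P _ hle ≫ kernel.ι c = 𝟙 _ := by
          rw [← cancel_mono P.arrow]
          simp
        have hc : c = 0 := by
          rw [← Category.id_comp c, ← h1, Category.assoc, kernel.condition, comp_zero]
        have hf1 : cokernel.π f = 0 := by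
          rw [← cancel_epi π, comp_zero]
          exact hc
        have : Epi f := Preadditive.epi_of_cokernel_zero hf1
        exact isIso_of_mono_of_epi f
      · refine absurd ?_ hf0
        have hle : Subobject.mk (kernel.ι c ≫ P.arrow) ≤ Q := h.le
        have h1 : kernel.ι c = Subobject.ofMkLE _ Q hle ≫ Q.ofLE P hQP.le := by
          rw [← cancel_mono P.arrow]
          simp
        have hz : kernel.ι c ≫ π = 0 := by
          rw [h1, Category.assoc, cokernel.condition, comp_zero]
        obtain ⟨A, ρ, hρ, x, hx⟩ := surjective_up_to_refinements_of_epi π f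
        have hx0 : x ≫ c = 0 := by
          rw [← reassoc_of% hx, cokernel.condition, comp_zero]
        rw [← cancel_epi ρ, hx, ← kernel.lift_ι _ x hx0, Category.assoc, hz, comp_zero, comp_zero]
  exact (key ⊤ (W.prop_of_iso (asIso (⊤ : Subobject M).arrow).symm hM)).of_iso
    (asIso (⊤ : Subobject M).arrow)

theorem torsClosure_filtBy : torsClosure (FiltBy S) = torsClosure S :=
  le_antisymm (torsClosure_le_iff.2 ((torsClosure S).2.filtBy_le (le_torsClosure S)))
    (torsClosure_mono fun _ h => .of_prop h)

theorem leftPerp_filtBy : leftPerp (FiltBy S) = leftPerp S := by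
  refine le_antisymm (leftPerp_anti fun _ h => .of_prop h) fun M hM Y f hY => ?_
  induction hY with
  | zero h => exact h.eq_zero_of_tgt f
  | step i p w h _ hZ ih =>
    have : Mono i := h.mono_f
    have hfp : f ≫ p = 0 := hM _ hZ
    have h1 : h.exact.lift f hfp ≫ i = f := h.exact.lift_f f hfp
    rw [← h1, ih (h.exact.lift f hfp), zero_comp]

end Wide

end TorsKappa

/-! ### Assembly of the bijections. -/

theorem theorem4 {C : Type u} [Category.{v} C] [Abelian C] (hC : IsLengthCategory C) :
    -- the kappa map is well defined on `tors C`: the maximum in its definition exists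
    (∀ j : Tors C, IsCompletelyJoinIrreducible j →
      IsGreatest {x : Tors C | j ⊓ x = lowerStar j} (kappa j)) ∧
    -- the extended kappa map is a bijection
    Set.BijOn extKappa (lowerZero (Tors C)) (upperZero (Tors C)) ∧
    -- `T` and the brick version of `CJR` are mutually inverse bijections
    Set.BijOn torsClosure (sbrick C) (lowerZero (Tors C)) ∧
    Set.BijOn cjrBricks (lowerZero (Tors C)) (sbrick C) ∧
    Set.InvOn cjrBricks torsClosure (sbrick C) (lowerZero (Tors C)) ∧
    -- `⊥(-)` and the brick version of `CMR` are mutually inverse bijections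
    Set.BijOn leftPerp (sbrick C) (upperZero (Tors C)) ∧
    Set.BijOn cmrBricks (upperZero (Tors C)) (sbrick C) ∧
    Set.InvOn cmrBricks leftPerp (sbrick C) (upperZero (Tors C)) ∧
    -- `Filt` and `simp` are mutually inverse bijections
    Set.BijOn filt (sbrick C) (wide C) ∧
    Set.BijOn simpleObjects (wide C) (sbrick C) ∧
    Set.InvOn simpleObjects filt (sbrick C) (wide C) ∧
    -- `T` and `⊥(-)` are bijections on wide subcategories
    Set.BijOn torsClosure (wide C) (lowerZero (Tors C)) ∧
    Set.BijOn leftPerp (wide C) (upperZero (Tors C)) ∧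
    -- the two triangles between semibricks and wide subcategories commute
    (∀ S ∈ sbrick C, torsClosure (filt S) = torsClosure S ∧ leftPerp (filt S) = leftPerp S) ∧
    (∀ W ∈ wide C, torsClosure (simpleObjects W) = torsClosure W ∧
      leftPerp (simpleObjects W) = leftPerp W) ∧
    -- the triangle of the extended kappa map commutes
    (∀ T ∈ lowerZero (Tors C), extKappa T = leftPerp (cjrBricks T) ∧
      cmrBricks (extKappa T) = cjrBricks T) ∧
    (∀ S ∈ sbrick C, extKappa (torsClosure S) = leftPerp S) ∧
    (∀ W ∈ wide C, extKappa (torsClosure W) = leftPerp W) := by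
  have hlow : Set.MapsTo torsClosure (sbrick C) (lowerZero (Tors C)) := fun _ hS =>
    ⟨_, isCanonicalJoinRep_torsClosure hS⟩
  have hup : Set.MapsTo leftPerp (sbrick C) (upperZero (Tors C)) := fun _ hS =>
    ⟨_, isCanonicalMeetRep_leftPerp hC hS⟩
  have hcjr : Set.MapsTo cjrBricks (lowerZero (Tors C)) (sbrick C) := fun _ =>
    cjrBricks_mem_sbrick
  have hcmr : Set.MapsTo cmrBricks (upperZero (Tors C)) (sbrick C) := fun _ =>
    cmrBricks_mem_sbrick
  have hfilt : Set.MapsTo filt (sbrick C) (wide C) := fun _ hS =>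
    filt_sbrick hS ▸ filtBy_mem_wide hS
  have hsimp : Set.MapsTo simpleObjects (wide C) (sbrick C) := fun _ => simpleObjects_mem_sbrick
  have invT : Set.InvOn cjrBricks torsClosure (sbrick C) (lowerZero (Tors C)) :=
    ⟨fun _ hS => cjrBricks_torsClosure hS, fun _ hT => torsClosure_cjrBricks hC hT⟩
  have invP : Set.InvOn cmrBricks leftPerp (sbrick C) (upperZero (Tors C)) :=
    ⟨fun _ hS => cmrBricks_leftPerp hC hS, fun _ hT => leftPerp_cmrBricks hC hT⟩
  have invF : Set.InvOn simpleObjects filt (sbrick C) (wide C) :=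
    ⟨fun _ hS => by rw [filt_sbrick hS, simpleObjects_filtBy hS],
      fun _ hW => by
        rw [filt_sbrick (simpleObjects_mem_sbrick hW), filtBy_simpleObjects hC hW]⟩
  have bijT := invT.bijOn hlow hcjr
  have bijP := invP.bijOn hup hcmr
  have bijS := invF.symm.bijOn hsimp hfilt
  have filtT : ∀ S ∈ sbrick C, torsClosure (filt S) = torsClosure S ∧
      leftPerp (filt S) = leftPerp S := fun S hS => by
    rw [filt_sbrick hS]
    exact ⟨torsClosure_filtBy, leftPerp_filtBy⟩
  have simpT : ∀ W ∈ wide C, torsClosure (simpleObjects W) = torsClosure W ∧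
      leftPerp (simpleObjects W) = leftPerp W := fun W hW => by
    have h := filtT _ (hsimp hW)
    rw [invF.2 hW] at h
    exact ⟨h.1.symm, h.2.symm⟩
  have kapT : ∀ T ∈ lowerZero (Tors C), extKappa T = leftPerp (cjrBricks T) := fun T hT => by
    conv_lhs => rw [← torsClosure_cjrBricks hC hT]
    exact extKappa_torsClosure (hcjr hT)
  refine ⟨fun j hj => ?_, ?_, bijT, invT.symm.bijOn hcjr hlow, invT, bijP,
    invP.symm.bijOn hcmr hup, invP, invF.bijOn hfilt hsimp, bijS, invF, ?_, ?_, filtT, simpT,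
    fun T hT => ⟨kapT T hT, ?_⟩, fun S hS => extKappa_torsClosure hS, fun W hW => ?_⟩
  · obtain ⟨B, hB, rfl⟩ := exists_brick_of_joinIrreducible hC hj
    rw [kappa_torsClosure hB]
    exact isGreatest_leftPerp hB
  -- On $L_0$ the extended kappa map is ${}^\perp(-)$ after the brick version of CJR, both
  -- bijective.
  · exact (bijP.comp (invT.symm.bijOn hcjr hlow)).congr fun T hT => (kapT T hT).symm
  · exact (bijT.comp bijS).congr fun W hW => (simpT W hW).1
  · exact (bijP.comp bijS).congr fun W hW => (simpT W hW).2
  · rw [kapT T hT]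
    exact cmrBricks_leftPerp hC (hcjr hT)
  · rw [← (simpT W hW).1, ← (simpT W hW).2]
    exact extKappa_torsClosure (hsimp hW)
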